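/- **Model.** Let $A,B$ be disjoint sets of $n$ players each. Each $z\in A\cup B$ holds a preference list $\pi_z$, a bijection from the opposite side to the ranks $\{1,\dots,n\}$ ($1$ is best). Time is discrete. In each time-step an algorithm may ask one comparison query $(z,u,v)$, answered by whether $\pi_z(u)<\pi_z(v)$ for the current lists, and then $\alpha$ independent evolution events occur, where the integer $\alpha\ge 1$ is a fixed constant: in one event, $z\in A\cup B$ and $i\in\{1,\dots,n-1\}$ are chosen uniformly at random and the elements of ranks $i$ and $i+1$ in $\pi_z$ are swapped. Evolution is not reported to the algorithm, and computation other than queries takes no time. A pair $(x,y)\in A\times B$ is blocking for a matching (bijection) $M:A\to B$ if $\pi_x(y)<\pi_x(M(x))$ and $\pi_y(x)<\pi_y(M^{-1}(y))$. **Algorithm.** Repeat forever: sort the $2n$ lists one after another, each by randomized quicksort (draw a uniformly random pivot, compare the other elements with it one at a time, one query per time-step on the evolving list, and recurse on the two parts), obtaining approximations $\tilde\pi_z$; then run the standard Gale–Shapley algorithm ($A$ proposes) on the lists $\tilde\pi_z$, and let the result be the output matching until the next round is completed. Before the first round is completed, the output is an arbitrary fixed matching. **Theorem.** For every integer $\alpha\ge1$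 there is a constant $c_0>0$ such that for every constant $c$ there are constants $n_0,c',c''>0$ with the following property. For every $n\ge n_0$, all initial preference lists, every initial output matching and every time-step $t\ge c_0n^2\log n$, the number $X_t$ of blocking pairs, with respect to the preference lists at time $t$, of the matching output at time $t$ satisfies $$\mathbb E[X_t]\le c'\,n\log n\qquad\text{and}\qquad \Pr\bigl(X_t>c''\,n\log n\bigr)\le n^{-c}.$$ -/

import Mathlib

open scoped ENNReal

namespace EvolvingMatching

/-! ### Instances of the stable matching problem

Both sides `A` and `B` are copies of `Fin n`. Ranks are `0, …, n - 1`, and `0` is the best one. -/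

/-- The players, `A ⊕ B`. -/
abbrev Player (n : ℕ) : Type := Fin n ⊕ Fin n

/-- Preference lists: `π z u` is the rank of `u` (a member of the side opposite to `z`)
in the list of the player `z`. -/
abbrev Prefs (n : ℕ) : Type := Player n → Equiv.Perm (Fin n)

/-- A matching: a bijection from `A` to `B`. -/
abbrev Matching (n : ℕ) : Type := Fin n ≃ Fin n

/-- `(x, y)` with `x ∈ A`, `y ∈ B` is blocking if `x` prefers `y` to its match and `y` prefers
`x` to its match. -/
def IsBlocking {n : ℕ} (π : Prefs n) (M : Matching n) (x y : Fin n) : Prop :=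
  π (Sum.inl x) y < π (Sum.inl x) (M x) ∧ π (Sum.inr y) x < π (Sum.inr y) (M.symm y)

/-- The number of blocking pairs. -/
noncomputable def numBlocking {n : ℕ} (π : Prefs n) (M : Matching n) : ℕ :=
  Set.ncard {p : Fin n × Fin n | IsBlocking π M p.1 p.2}

/-! ### Evolution -/

/-- Swap the elements of ranks `i` and `i + 1` in the list of `z`. -/
def swapEvent {n : ℕ} (π : Prefs n) (z : Player n) (i : Fin (n - 1)) : Prefs n :=
  Function.update π z
    ((π z).trans (Equiv.swap ⟨i, by have := i.isLt; omega⟩ ⟨i + 1, by have := i.isLt; omega⟩))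

open Classical in
/-- One evolution event: a uniformly random player and a uniformly random pair of adjacent
ranks. (There is nothing to swap if `n ≤ 1`.) -/
noncomputable def evolveOnce {n : ℕ} (π : Prefs n) : PMF (Prefs n) :=
  if _h : Nonempty (Player n × Fin (n - 1)) then
    (PMF.uniformOfFintype (Player n × Fin (n - 1))).map fun e => swapEvent π e.1 e.2
  else PMF.pure π

/-- `k` consecutive independent evolution events. -/
noncomputable def evolve {n : ℕ} : ℕ → Prefs n → PMF (Prefs n)
  | 0, π => PMF.pure π
  | k + 1, π => (evolveOnce π).bind (evolve k)

/-! ### Randomized algorithms with comparison queries -/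

/-- A randomized algorithm that accesses the preference lists only through comparison queries:
it either returns a result, or asks whether `π z u < π z v` and goes on according to the answer,
or draws a uniformly random element of `Fin (m + 1)` and goes on according to it. -/
inductive QueryAlg (n : ℕ) (X : Type) : Type
  | ret : X → QueryAlg n X
  | query : Player n → Fin n → Fin n → (Bool → QueryAlg n X) → QueryAlg n X
  | rand : (m : ℕ) → (Fin (m + 1) → QueryAlg n X) → QueryAlg n X

namespace QueryAlg

/-- Run an algorithm and then another one that depends on its result. -/
def bind {n : ℕ} {X Y : Type} : QueryAlg n X → (X → QueryAlg n Y) → QueryAlg n Y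
  | ret a, g => g a
  | query z u v k, g => query z u v fun b => (k b).bind g
  | rand m k, g => rand m fun i => (k i).bind g

/-- Draw random numbers until the algorithm asks a query or returns. -/
noncomputable def settle {n : ℕ} {X : Type} : QueryAlg n X → PMF (QueryAlg n X)
  | ret a => PMF.pure (ret a)
  | query z u v k => PMF.pure (query z u v k)
  | rand m k => (PMF.uniformOfFintype (Fin (m + 1))).bind fun i => (k i).settle

/-- Answer the pending query, if any, according to the current preference lists. -/
def answer {n : ℕ} {X : Type} (π : Prefs n) : QueryAlg n X → QueryAlg n X
  | query z u v k => k (decide (π z u < π z v))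
  | a => a

end QueryAlg

/-! ### Sorting -/

/-- Compare the elements of a list one after another with the pivot `p` according to the list of
`z`, and return the list of those that come before `p` and the list of the others. -/
def partition {n : ℕ} (z : Player n) (p : Fin n) :
    (l : List (Fin n)) →
      QueryAlg n {q : List (Fin n) × List (Fin n) // List.Perm (q.1 ++ q.2) l}
  | [] => .ret ⟨([], []), by simp⟩
  | u :: l => .query z u p fun b => (partition z p l).bind fun q =>
      .ret (match b with
        | true => ⟨(u :: q.1.1, q.1.2), by simpa using q.2⟩
        | false => ⟨(q.1.1, u :: q.1.2), List.perm_middle.trans (q.2.cons u)⟩)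

/-- Randomized quicksort of `l` according to the list of `z`: draw a uniformly random pivot,
partition the other elements, and sort the two parts recursively. -/
def quicksort {n : ℕ} (z : Player n) (l : List (Fin n)) :
    QueryAlg n {l' : List (Fin n) // List.Perm l' l} :=
  match l with
  | [] => .ret ⟨[], List.Perm.refl _⟩
  | a :: as => .rand as.length fun i =>
      (partition z (a :: as)[i] ((a :: as).eraseIdx i)).bind fun q =>
        have hq : q.1.1.length + q.1.2.length = as.length := by
          have h := q.2.length_eq
          rw [List.length_append, List.length_eraseIdx_of_lt i.isLt] at h
          simpa using h
        (quicksort z q.1.1).bind fun lo => (quicksort z q.1.2).bind fun hi =>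
          .ret ⟨lo.1 ++ (a :: as)[i] :: hi.1,
            List.perm_middle.trans ((((lo.2.append hi.2).trans q.2).cons _).trans
              (List.getElem_cons_eraseIdx_perm i.isLt))⟩
  termination_by l.length
  decreasing_by
    all_goals simp only [List.length_cons]; omega

/-- An ordered list, best element first, of all the elements of `Fin n`. -/
abbrev Ranking (n : ℕ) : Type := {l : List (Fin n) // List.Perm l (List.finRange n)}

/-- The position of each element in a ranking. -/
def Ranking.toPerm {n : ℕ} (l : Ranking n) : Equiv.Perm (Fin n) :=
  ((finCongr (by simpa using l.2.length_eq.symm)).trans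
    (List.Nodup.getEquivOfForallMemList l.1 (l.2.nodup_iff.2 (List.nodup_finRange n))
      fun x => l.2.mem_iff.2 (List.mem_finRange x))).symm

/-- Sort the lists of the given players one after another; the results overwrite `acc`. -/
def sequentialSort {n : ℕ} : List (Player n) → Prefs n → QueryAlg n (Prefs n)
  | [], acc => .ret acc
  | z :: zs, acc => (quicksort z (List.finRange n)).bind fun l =>
      sequentialSort zs (Function.update acc z (Ranking.toPerm l))

/-- All players, the `A` side first. -/
def allPlayers (n : ℕ) : List (Player n) :=
  (List.finRange n).map Sum.inl ++ (List.finRange n).map Sum.inr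

/-! ### The Gale–Shapley algorithm -/

/-- A state of the Gale–Shapley algorithm: the number of proposals that each `x ∈ A` has made,
and the current partner, if any, of each `y ∈ B`. -/
structure GSState (n : ℕ) where
  proposals : Fin n → ℕ
  partner : Fin n → Option (Fin n)

/-- Initially there are no proposals and everyone is unmatched. -/
def GSState.init (n : ℕ) : GSState n := ⟨fun _ => 0, fun _ => none⟩

/-- The first unmatched member of `A`. -/
def GSState.firstFree {n : ℕ} (s : GSState n) : Option (Fin n) :=
  (List.finRange n).find? fun x => decide (∀ y, s.partner y ≠ some x)

/-- Does `y` accept a proposal of `x`? -/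
def GSState.accepts {n : ℕ} (σ : Prefs n) (s : GSState n) (y x : Fin n) : Bool :=
  match s.partner y with
  | none => true
  | some x' => decide (σ (Sum.inr y) x < σ (Sum.inr y) x')

/-- One proposal: the first unmatched `x ∈ A` proposes to the best `y ∈ B` to whom it has not
yet proposed; `y` accepts if it is unmatched or prefers `x` to its partner, who then becomes
unmatched. Nothing happens if everyone is matched. -/
def gsStep {n : ℕ} (σ : Prefs n) (s : GSState n) : GSState n :=
  match s.firstFree with
  | none => s
  | some x =>
      if h : s.proposals x < n then
        let y := (σ (Sum.inl x)).symm ⟨s.proposals x, h⟩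
        { proposals := Function.update s.proposals x (s.proposals x + 1)
          partner := if s.accepts σ y x then Function.update s.partner y (some x)
            else s.partner }
      else s

/-- The final state. There are at most `n * n` proposals. -/
def gsFinal {n : ℕ} (σ : Prefs n) : GSState n := (gsStep σ)^[n * n] (GSState.init n)

/-- Invariant of the algorithm: nobody in `A` has two partners, and whoever received a proposal
is matched. -/
structure GSState.Inv {n : ℕ} (σ : Prefs n) (s : GSState n) : Prop where
  inj : ∀ y y' x, s.partner y = some x → s.partner y' = some x → y = y'
  le : ∀ x, s.proposals x ≤ n
  matched : ∀ x y, (σ (Sum.inl x) y : ℕ) < s.proposals x → s.partner y ≠ none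

theorem GSState.Inv.proposals_lt {n : ℕ} {σ : Prefs n} {s : GSState n} (h : s.Inv σ)
    {x : Fin n} (hx : ∀ y, s.partner y ≠ some x) : s.proposals x < n := by
  by_contra hlt
  have hall : ∀ y, ∃ x', s.partner y = some x' := fun y =>
    Option.ne_none_iff_exists'.1 (h.matched x y (by have := (σ (Sum.inl x) y).isLt; omega))
  choose f hf using hall
  have hinj : Function.Injective f := fun y y' e => h.inj y y' (f y) (hf y) (e ▸ hf y')
  obtain ⟨y, hy⟩ := Finite.surjective_of_injective hinj x
  exact hx y (hy ▸ hf y)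

theorem GSState.firstFree_some {n : ℕ} {s : GSState n} {x : Fin n} (h : s.firstFree = some x) :
    ∀ y, s.partner y ≠ some x := by
  simpa using List.find?_some h

theorem GSState.firstFree_none {n : ℕ} {s : GSState n} (h : s.firstFree = none) (x : Fin n) :
    ∃ y, s.partner y = some x := by
  have := List.find?_eq_none.1 h x (List.mem_finRange x)
  simpa using this

theorem gsStep_inv {n : ℕ} {σ : Prefs n} {s : GSState n} (h : s.Inv σ) :
    (gsStep σ s).Inv σ := by
  unfold gsStep
  split
  · exact h
  · rename_i x hx
    have hfree := GSState.firstFree_some hx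
    have hlt := h.proposals_lt hfree
    rw [dif_pos hlt]
    set y₀ := (σ (Sum.inl x)).symm ⟨s.proposals x, hlt⟩ with hy₀
    refine ⟨?_, ?_, ?_⟩
    · intro y y' w h1 h2
      dsimp only at h1 h2
      split_ifs at h1 h2 with hacc
      · simp only [Function.update_apply] at h1 h2
        split_ifs at h1 h2 with e1 e2 e2
        · rw [e1, e2]
        · exact absurd (h2.trans h1.symm) (hfree y')
        · exact absurd (h1.trans h2.symm) (hfree y)
        · exact h.inj y y' w h1 h2
      · exact h.inj y y' w h1 h2
    · intro w
      have := h.le w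
      dsimp only
      rw [Function.update_apply]
      split_ifs with e <;> omega
    · intro w y hw
      dsimp only at hw ⊢
      have key : s.partner y ≠ none ∨ y = y₀ := by
        rw [Function.update_apply] at hw
        split_ifs at hw with e
        · subst e
          rcases Nat.lt_succ_iff_lt_or_eq.1 hw with h1 | h1
          · exact Or.inl (h.matched _ y h1)
          · right
            rw [hy₀, Equiv.eq_symm_apply]
            exact Fin.ext h1
        · exact Or.inl (h.matched w y hw)
      split_ifs with hacc
      · rw [Function.update_apply]
        split_ifs with e
        · simp
        · exact key.resolve_right e
      · rcases key with k | k
        · exact k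
        · intro hn
          rw [k] at hn
          exact hacc (by simp [GSState.accepts, hn])

theorem gsIter_inv {n : ℕ} (σ : Prefs n) (k : ℕ) :
    ((gsStep σ)^[k] (GSState.init n)).Inv σ := by
  induction k with
  | zero => exact ⟨by simp [GSState.init], by simp [GSState.init], by simp [GSState.init]⟩
  | succ k ih => rw [Function.iterate_succ_apply']; exact gsStep_inv ih

theorem gsIter_progress {n : ℕ} (σ : Prefs n) (k : ℕ) :
    ((gsStep σ)^[k] (GSState.init n)).firstFree = none ∨
      ∑ x, ((gsStep σ)^[k] (GSState.init n)).proposals x = k := by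
  induction k with
  | zero => right; simp [GSState.init]
  | succ k ih =>
    rw [Function.iterate_succ_apply']
    have hinv := gsIter_inv σ k
    generalize (gsStep σ)^[k] (GSState.init n) = s at ih hinv
    cases hx : s.firstFree with
    | none => left; simp [gsStep, hx]
    | some x =>
      right
      have hlt := hinv.proposals_lt (GSState.firstFree_some hx)
      have hs : ∑ w, s.proposals w = k := by simpa [hx] using ih
      have : (gsStep σ s).proposals = Function.update s.proposals x (s.proposals x + 1) := by
        simp [gsStep, hx, hlt]
      rw [this, Finset.sum_update_of_mem (Finset.mem_univ x)]
      have := Finset.add_sum_erase Finset.univ s.proposals (Finset.mem_univ x)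
      rw [← Finset.erase_eq]
      omega

theorem gsFinal_firstFree {n : ℕ} (σ : Prefs n) : (gsFinal σ).firstFree = none := by
  rcases gsIter_progress σ (n * n) with h | h
  · exact h
  · have hinv := gsIter_inv σ (n * n)
    cases hx : (gsFinal σ).firstFree with
    | none => rfl
    | some x =>
      exfalso
      have hlt := hinv.proposals_lt (GSState.firstFree_some hx)
      have := Finset.sum_lt_sum (fun w _ => hinv.le w) ⟨x, Finset.mem_univ x, hlt⟩
      rw [h] at this
      simp at this

/-- The Gale–Shapley algorithm ends with a perfect matching. -/
theorem gsFinal_perfect {n : ℕ} (σ : Prefs n) :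
    ∃ M : Matching n, ∀ x, (gsFinal σ).partner (M x) = some x := by
  choose f hf using GSState.firstFree_none (gsFinal_firstFree σ)
  have hinj : Function.Injective f := fun x x' e => by
    have := hf x
    rw [e, hf x'] at this
    exact (Option.some.inj this).symm
  exact ⟨Equiv.ofBijective f (Finite.injective_iff_bijective.1 hinj), hf⟩

/-- The matching computed by the Gale–Shapley algorithm on the preference lists `σ`. -/
noncomputable def galeShapley {n : ℕ} (σ : Prefs n) : Matching n :=
  (gsFinal_perfect σ).choose

/-! ### The dynamic algorithm -/

/-- One round: sort all `2n` lists sequentially, then run Gale–Shapley on the sorted lists.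
(The initial value `fun _ => 1` of the result of the sorting is completely overwritten.) -/
noncomputable def matchRound (n : ℕ) : QueryAlg n (Matching n) :=
  (sequentialSort (allPlayers n) fun _ => 1).bind fun σ => .ret (galeShapley σ)

/-- The state after some time-step: the current preference lists, the matching that is currently
maintained as the output, and the rest of the current round of the algorithm. -/
structure Config (n : ℕ) where
  prefs : Prefs n
  matching : Matching n
  rest : QueryAlg n (Matching n)

/-- If the round has returned a matching, output it and start the next round. -/
noncomputable def Config.restart {n : ℕ} (s : Config n) : Config n :=
  match s.rest with
  | .ret M => ⟨s.prefs, M, matchRound n⟩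
  | _ => s

/-- One time-step with evolution rate `α`: the algorithm asks one query, which is answered
according to the current lists, computes until its next query, and `α` evolution events occur.
Everything other than queries takes no time. -/
noncomputable def timeStep {n : ℕ} (α : ℕ) (s : Config n) : PMF (Config n) :=
  s.rest.settle.bind fun a =>
    (a.answer s.prefs).settle.bind fun a' =>
      (evolve α s.prefs).map fun π' => Config.restart ⟨π', s.matching, a'⟩

/-- The law of the state after `t` time-steps, from initial preference lists `π₀` and an
initial output `M₀`. -/
noncomputable def configLaw {n : ℕ} (α : ℕ) (π₀ : Prefs n) (M₀ : Matching n) : ℕ → PMF (Config n)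
  | 0 => PMF.pure ⟨π₀, M₀, matchRound n⟩
  | t + 1 => (configLaw α π₀ M₀ t).bind (timeStep α)

/-- The law of the number of blocking pairs, with respect to the current preference lists, of the
matching that is maintained at time-step `t`. -/
noncomputable def blockingLaw {n : ℕ} (α : ℕ) (π₀ : Prefs n) (M₀ : Matching n) (t : ℕ) : PMF ℕ :=
  (configLaw α π₀ M₀ t).map fun s => numBlocking s.prefs s.matching

/-- The expectation of a random natural number. -/
noncomputable def expectation (p : PMF ℕ) : ℝ≥0∞ := ∑' k : ℕ, p k * (k : ℝ≥0∞)

end EvolvingMatching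

namespace EvolvingMatching

/-! Let `σ` be the sorted lists of a round and `π` the actual lists at a later time. The
Gale–Shapley matching for `σ` is stable for `σ`, so a pair that blocks it for `π` contains a player
`z` for whom `σ z` and `π z` order the other member of the pair and the partner of `z` differently.
Hence there are at most `2n · max dOrd (σ z) (π z) v` blocking pairs (`numBlocking_galeShapley_le`),
and it suffices that all these numbers are O(log n) with high probability.

The discrepancy in the list of `z` has two sources. While this list is being sorted, the answers may
be inconsistent; yet an element whose order relative to all others stays constant during the sort
still splits the output correctly (`quicksort_split`). So the error relative to any `v` is at most
the number of elements that move (`dOrd_quicksort_le`). The sort takes O(n log n) steps and an event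
hits the list with probability 1/(2n), so this number is O(log n). Later, an event changes the order
relative to a fixed `v` with probability at most 1/(n(n-1)), and typically O(n² log n) steps pass
before the output is replaced: again O(log n).

All tails come from exponential moments and Markov's inequality. For a subadditive count `f` of
changes, the moments of `2 ^ f` multiply along the run (`ex_run_take_le`). The duration of quicksort
obeys the static recursion with a small correction, since the pivot moves during a query with
probability at most 4α/n² (`ex_partition_le`, `sortMoment_recursion`).

The output comes from the round before the one in progress, and the start of that round is random.
`prob_observe_le` avoids conditioning on it by a union bound over the time `j` elapsed since that
start, with bounds uniform in the lists at the start. For `j` up to order n² log n the accuracy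
bound is polynomially small; for larger `j`, two rounds would have to last unusually long, with
probability decaying geometrically in `j`. The expectation follows from the tail bound with exponent
at least 2, because there are never more than n² blocking pairs. -/

/-! ### Expectations -/

/-- The expectation of a function with values in `[0, ∞]`. -/
noncomputable def ex {X : Type*} (p : PMF X) (f : X → ℝ≥0∞) : ℝ≥0∞ := ∑' x, p x * f x

section ex

variable {X Y : Type*}

theorem ex_pure (a : X) (f : X → ℝ≥0∞) : ex (PMF.pure a) f = f a := by
  classical
  unfold ex
  rw [tsum_eq_single a]
  · simp
  · intro b hb; simp [PMF.pure_apply, hb]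

theorem ex_bind (p : PMF X) (g : X → PMF Y) (f : Y → ℝ≥0∞) :
    ex (p.bind g) f = ex p fun x => ex (g x) f := by
  unfold ex
  simp_rw [PMF.bind_apply, ← ENNReal.tsum_mul_right, ← ENNReal.tsum_mul_left]
  rw [ENNReal.tsum_comm]
  simp_rw [mul_assoc]

theorem ex_map (p : PMF X) (g : X → Y) (f : Y → ℝ≥0∞) :
    ex (p.map g) f = ex p fun x => f (g x) := by
  rw [← PMF.bind_pure_comp, ex_bind]
  simp [ex_pure]

theorem ex_mono_support {p : PMF X} {f g : X → ℝ≥0∞} (h : ∀ x ∈ p.support, f x ≤ g x) :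
    ex p f ≤ ex p g := by
  refine ENNReal.tsum_le_tsum fun x => ?_
  by_cases hx : p x = 0
  · simp [hx]
  · exact mul_le_mul_right (h x ((PMF.mem_support_iff _ _).2 hx)) _

theorem ex_mono {p : PMF X} {f g : X → ℝ≥0∞} (h : ∀ x, f x ≤ g x) : ex p f ≤ ex p g :=
  ex_mono_support fun x _ => h x

theorem ex_const (p : PMF X) (c : ℝ≥0∞) : ex p (fun _ => c) = c := by
  unfold ex
  rw [ENNReal.tsum_mul_right, p.tsum_coe, one_mul]

theorem ex_le {p : PMF X} {f : X → ℝ≥0∞} {c : ℝ≥0∞} (h : ∀ x, f x ≤ c) : ex p f ≤ c :=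
  (ex_mono h).trans_eq (ex_const p c)

theorem ex_add (p : PMF X) (f g : X → ℝ≥0∞) :
    ex p (fun x => f x + g x) = ex p f + ex p g := by
  unfold ex
  simp_rw [mul_add]
  exact ENNReal.tsum_add

theorem ex_const_mul (p : PMF X) (c : ℝ≥0∞) (f : X → ℝ≥0∞) :
    ex p (fun x => c * f x) = c * ex p f := by
  unfold ex
  rw [← ENNReal.tsum_mul_left]
  exact tsum_congr fun x => by ring

theorem ex_mul_const (p : PMF X) (c : ℝ≥0∞) (f : X → ℝ≥0∞) :
    ex p (fun x => f x * c) = ex p f * c := by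
  simp_rw [mul_comm _ c, ex_const_mul]

theorem ex_sum {ι : Type*} (s : Finset ι) (p : PMF X) (f : ι → X → ℝ≥0∞) :
    ex p (fun x => ∑ i ∈ s, f i x) = ∑ i ∈ s, ex p (f i) := by
  classical
  induction s using Finset.induction_on with
  | empty => simp [ex]
  | insert i s hi ih => simp_rw [Finset.sum_insert hi, ex_add, ih]

theorem ex_uniform [Fintype X] [Nonempty X] (f : X → ℝ≥0∞) :
    ex (PMF.uniformOfFintype X) f = (Fintype.card X : ℝ≥0∞)⁻¹ * ∑ x, f x := by
  unfold ex
  rw [tsum_fintype, Finset.mul_sum]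
  simp

open Classical in
/-- The probability of an event. -/
noncomputable def prob (p : PMF X) (P : X → Prop) : ℝ≥0∞ := ex p fun x => if P x then 1 else 0

theorem prob_eq_toOuterMeasure (p : PMF X) (S : Set X) :
    p.toOuterMeasure S = prob p (· ∈ S) := by
  classical
  rw [PMF.toOuterMeasure_apply]
  unfold prob ex
  refine tsum_congr fun x => ?_
  by_cases h : x ∈ S <;> simp [h]

theorem prob_mono {p : PMF X} {P Q : X → Prop} (h : ∀ x, P x → Q x) : prob p P ≤ prob p Q :=
  ex_mono fun x => by
    by_cases hp : P x
    · simp [hp, h x hp]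
    · simp [hp]

theorem prob_mono_support {p : PMF X} {P Q : X → Prop} (h : ∀ x ∈ p.support, P x → Q x) :
    prob p P ≤ prob p Q :=
  ex_mono_support fun x hx => by
    by_cases hp : P x
    · simp [hp, h x hx hp]
    · simp [hp]

theorem prob_le_one (p : PMF X) (P : X → Prop) : prob p P ≤ 1 :=
  ex_le fun x => by split_ifs <;> simp

theorem prob_or_le (p : PMF X) (P Q : X → Prop) :
    prob p (fun x => P x ∨ Q x) ≤ prob p P + prob p Q := by
  unfold prob
  rw [← ex_add]
  refine ex_mono fun x => ?_
  by_cases hP : P x <;> by_cases hQ : Q x <;> simp [hP, hQ]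

theorem prob_exists_le {ι : Type*} [Fintype ι] (p : PMF X) (P : ι → X → Prop) :
    prob p (fun x => ∃ i, P i x) ≤ ∑ i, prob p (P i) := by
  unfold prob
  rw [← ex_sum]
  refine ex_mono fun x => ?_
  split_ifs with h
  · obtain ⟨i, hi⟩ := h
    refine le_trans ?_ (Finset.single_le_sum (fun _ _ => zero_le) (Finset.mem_univ i))
    simp [hi]
  · exact zero_le

theorem prob_map (p : PMF X) (g : X → Y) (P : Y → Prop) :
    prob (p.map g) P = prob p fun x => P (g x) := ex_map _ _ _

theorem prob_bind (p : PMF X) (g : X → PMF Y) (P : Y → Prop) :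
    prob (p.bind g) P = ex p fun x => prob (g x) P := ex_bind _ _ _

/-- Markov's inequality, with `c` in the role of the reciprocal of the threshold. -/
theorem prob_le_of_mul_le {p : PMF X} {P : X → Prop} {f : X → ℝ≥0∞} {c : ℝ≥0∞}
    (h : ∀ x, P x → 1 ≤ c * f x) : prob p P ≤ c * ex p f := by
  rw [← ex_const_mul]
  refine ex_mono fun x => ?_
  split_ifs with hx
  · exact h x hx
  · exact zero_le

/-- If the event `P` of a composite experiment implies an event `Q` of the first part or an event
of the second part whose conditional probability is always at most `c`, then the probability of
`P` is at most the probability of `Q` plus `c`. -/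
theorem prob_bind_le {p : PMF X} {g : X → PMF Y} {P : Y → Prop} {Q : X → Prop} {c : ℝ≥0∞}
    (h : ∀ x ∈ p.support, ¬ Q x → prob (g x) P ≤ c) : prob (p.bind g) P ≤ prob p Q + c := by
  rw [prob_bind, ← ex_const p c, prob, ← ex_add]
  refine ex_mono_support fun x hx => ?_
  by_cases hQ : Q x
  · simpa [hQ] using (prob_le_one _ _).trans le_self_add
  · simpa [hQ] using h x hx hQ

end ex

/-! ### Runs of a randomized algorithm -/

variable {n : ℕ}

/-- Run an algorithm, with `α` evolution events after each query. Besides the result, keep the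
preference lists after each query. -/
noncomputable def run (α : ℕ) {X : Type} :
    QueryAlg n X → Prefs n → PMF (X × List (Prefs n))
  | .ret a, _ => PMF.pure (a, [])
  | .query z u v k, π => (evolve α π).bind fun π' =>
      (run α (k (decide (π z u < π z v))) π').map fun r => (r.1, π' :: r.2)
  | .rand m k, π => (PMF.uniformOfFintype (Fin (m + 1))).bind fun i => run α (k i) π

theorem run_bind (α : ℕ) {X Y : Type} (a : QueryAlg n X) (g : X → QueryAlg n Y) (π : Prefs n) :
    run α (a.bind g) π = (run α a π).bind fun r =>
      (run α (g r.1) (r.2.getLastD π)).map fun q => (q.1, r.2 ++ q.2) := by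
  induction a generalizing π with
  | ret a => 
    simp only [QueryAlg.bind, run, PMF.pure_bind, List.getLastD_nil, List.nil_append]
    exact (PMF.map_id _).symm
  | query z u v k ih =>
    simp only [QueryAlg.bind, run, ih, PMF.bind_bind, PMF.bind_map, PMF.map_bind, PMF.map_comp,
      Function.comp_def, List.getLastD_cons, List.cons_append]
  | rand m k ih => simp only [QueryAlg.bind, run, ih, PMF.bind_bind]

theorem run_bind_ret (α : ℕ) {X Y : Type} (a : QueryAlg n X) (g : X → Y) (π : Prefs n) :
    run α (a.bind fun x => .ret (g x)) π = (run α a π).map fun r => (g r.1, r.2) := by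
  simp [run_bind, run, ← PMF.bind_pure_comp, Function.comp_def]

/-! ### Renewal -/

/-- The law of the preference lists and of the output, `k` time-steps after the state `s`. -/
noncomputable def observe (α : ℕ) : ℕ → Config n → PMF (Prefs n × Matching n)
  | 0, s => PMF.pure (s.prefs, s.matching)
  | k + 1, s => (timeStep α s).bind (observe α k)

/-- The Markov property. `configLaw` adds steps at the end while `observe` removes them at the
front; the second form can be decomposed at the end of the current round. -/
theorem configLaw_bind_observe (α : ℕ) (π₀ : Prefs n) (M₀ : Matching n) (t k : ℕ) :
    (configLaw α π₀ M₀ t).bind (observe α k) = observe α (t + k) ⟨π₀, M₀, matchRound n⟩ := by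
  induction t generalizing k with
  | zero => simp [configLaw]
  | succ t ih =>
    rw [configLaw, PMF.bind_bind, show t + 1 + k = t + (k + 1) by ring, ← ih]
    rfl

theorem blockingLaw_eq (α : ℕ) (π₀ : Prefs n) (M₀ : Matching n) (t : ℕ) :
    blockingLaw α π₀ M₀ t =
      (observe α t ⟨π₀, M₀, matchRound n⟩).map fun s => numBlocking s.1 s.2 := by
  rw [← Nat.add_zero t, ← configLaw_bind_observe, PMF.map_bind]
  simp only [observe, PMF.pure_map, Nat.add_zero]
  rw [blockingLaw, ← PMF.bind_pure_comp]
  rfl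

/-- Needed because `timeStep` settles an algorithm that the preceding step has already settled. -/
theorem settle_settle {X : Type} (a : QueryAlg n X) :
    a.settle.bind QueryAlg.settle = a.settle := by
  induction a with
  | ret a => simp [QueryAlg.settle]
  | query z u v k ih => simp [QueryAlg.settle]
  | rand m k ih => simp only [QueryAlg.settle, PMF.bind_bind, ih]

/-- The law of the observation after `k` further time-steps, given the trace of the current
round. -/
noncomputable def afterRound (α k : ℕ) (π : Prefs n) (M : Matching n)
    (r : Matching n × List (Prefs n)) : PMF (Prefs n × Matching n) :=
  if r.2.length ≤ k then observe α (k - r.2.length) ⟨r.2.getLastD π, r.1, matchRound n⟩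
  else PMF.pure ((r.2.take k).getLastD π, M)

/-- Passage from single time-steps to whole rounds: the complete trace of the round is generated at
once, and `afterRound` reads the state after `k` steps from it. -/
theorem settle_bind_observe (α k : ℕ) (π : Prefs n) (M : Matching n)
    (a : QueryAlg n (Matching n)) :
    (a.settle.bind fun b => observe α k (Config.restart ⟨π, M, b⟩)) =
      (run α a π).bind (afterRound α k π M) := by
  induction a generalizing k π with
  | ret a => simp [QueryAlg.settle, run, Config.restart, afterRound]
  | rand m f ih => simp only [QueryAlg.settle, run, PMF.bind_bind, ih]
  | query z u v f ih =>
    simp only [QueryAlg.settle, run, PMF.pure_bind, Config.restart, PMF.bind_bind, PMF.bind_map]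
    cases k with
    | zero => simp [observe, afterRound, Function.comp_def]
    | succ k =>
      simp only [observe, timeStep, QueryAlg.settle, PMF.pure_bind, QueryAlg.answer,
        PMF.bind_bind, PMF.bind_map]
      -- `timeStep` draws the next coins before the evolution, `run` after it; the two draws are
      -- independent.
      rw [PMF.bind_comm]
      refine congrArg _ (funext fun π' => ?_)
      have := ih (decide (π z u < π z v)) k π'
      simp only [Function.comp_def]
      rw [this]
      refine congrArg _ (funext fun r => ?_)
      simp only [afterRound, List.length_cons, Nat.add_le_add_iff_right, Nat.add_sub_add_right,
        List.take_succ_cons, List.getLastD_cons]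

theorem observe_matchRound (α k : ℕ) (π : Prefs n) (M : Matching n)
    (h : ∀ b ∈ (matchRound n).settle.support, ∀ M', b ≠ .ret M') :
    observe α k ⟨π, M, matchRound n⟩ =
      (run α (matchRound n) π).bind (afterRound α k π M) := by
  rw [← settle_bind_observe]
  have h1 : ∀ b ∈ (matchRound n).settle.support,
      Config.restart ⟨π, M, b⟩ = (⟨π, M, b⟩ : Config n) := by
    intro b hb
    cases b with
    | ret M' => exact absurd rfl (h _ hb M')
    | query => rfl
    | rand => rfl
  have h2 : ((matchRound n).settle.bind fun b => observe α k (Config.restart ⟨π, M, b⟩)) =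
      (matchRound n).settle.bind fun b => observe α k ⟨π, M, b⟩ := by
    ext x
    rw [PMF.bind_apply, PMF.bind_apply]
    refine tsum_congr fun b => ?_
    by_cases hb : b ∈ (matchRound n).settle.support
    · rw [h1 b hb]
    · rw [(PMF.apply_eq_zero_iff _ _).2 hb]; simp
  rw [h2]
  cases k with
  | zero => simp [observe]
  | succ k =>
    simp only [observe, timeStep]
    nth_rw 1 [← settle_settle]
    simp only [PMF.bind_bind]

/-! ### A round asks at least one query -/

/-- The algorithm does not return before its first query. -/
def NoRet {X : Type} (a : QueryAlg n X) : Prop := ∀ b ∈ a.settle.support, ∀ x, b ≠ .ret x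

theorem NoRet.bind {X Y : Type} {a : QueryAlg n X} (h : NoRet a) (g : X → QueryAlg n Y) :
    NoRet (a.bind g) := by
  induction a with
  | ret x => exact absurd rfl (h (.ret x) (by simp [QueryAlg.settle]) x)
  | query z u v k ih =>
    intro b hb y
    simp only [QueryAlg.bind, QueryAlg.settle, PMF.mem_support_pure_iff] at hb
    simp [hb]
  | rand m k ih =>
    intro b hb
    simp only [QueryAlg.bind, QueryAlg.settle, PMF.mem_support_bind_iff] at hb
    obtain ⟨i, hi, hb⟩ := hb
    exact ih i (fun c hc => h c (by
      simp only [QueryAlg.settle, PMF.mem_support_bind_iff]; exact ⟨i, hi, hc⟩)) b hb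

theorem noRet_partition (z : Player n) (p : Fin n) {l : List (Fin n)} (h : l ≠ []) :
    NoRet (partition z p l) := by
  cases l with
  | nil => exact absurd rfl h
  | cons u l => intro b hb x; simp [partition, QueryAlg.settle] at hb; simp [hb]

theorem noRet_quicksort (z : Player n) {l : List (Fin n)} (h : 2 ≤ l.length) :
    NoRet (quicksort z l) := by
  cases l with
  | nil => simp at h
  | cons a as =>
    rw [quicksort]
    intro b hb
    simp only [QueryAlg.settle, PMF.mem_support_bind_iff] at hb
    obtain ⟨i, -, hb⟩ := hb
    refine NoRet.bind (noRet_partition z _ ?_) _ b hb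
    rw [← List.length_pos_iff, List.length_eraseIdx_of_lt i.isLt]
    simp only [List.length_cons] at h ⊢
    omega

/-- Sorting two or more elements needs a comparison. So every round takes time, which makes the
induction over rounds in `prob_observe_le` well-founded. -/
theorem noRet_matchRound (hn : 2 ≤ n) : NoRet (matchRound n) := by
  refine NoRet.bind ?_ _
  obtain ⟨m, rfl⟩ : ∃ m, n = m + 1 := ⟨n - 1, by omega⟩
  rw [allPlayers, List.finRange_succ, List.map_cons, List.cons_append, sequentialSort]
  exact NoRet.bind (noRet_quicksort _ (by simpa [← List.finRange_succ] using hn)) _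

/-! ### Changes of order -/

/-- The number of elements whose order relative to `v` differs in `τ` and `τ'`. -/
def dOrd (τ τ' : Equiv.Perm (Fin n)) (v : Fin n) : ℕ :=
  (Finset.univ.filter fun w => ¬(τ w < τ v ↔ τ' w < τ' v)).card

/-- The number of elements whose order relative to some element differs in `τ` and `τ'`. -/
def dMov (τ τ' : Equiv.Perm (Fin n)) : ℕ :=
  (Finset.univ.filter fun v => ∃ w, ¬(τ w < τ v ↔ τ' w < τ' v)).card

theorem dOrd_triangle (τ τ' τ'' : Equiv.Perm (Fin n)) (v : Fin n) :
    dOrd τ τ'' v ≤ dOrd τ τ' v + dOrd τ' τ'' v := by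
  refine (Finset.card_le_card fun w hw => ?_).trans (Finset.card_union_le _ _)
  simp only [Finset.mem_union, Finset.mem_filter, Finset.mem_univ, true_and] at hw ⊢
  tauto

theorem dMov_triangle (τ τ' τ'' : Equiv.Perm (Fin n)) :
    dMov τ τ'' ≤ dMov τ τ' + dMov τ' τ'' := by
  refine (Finset.card_le_card fun v hv => ?_).trans (Finset.card_union_le _ _)
  simp only [Finset.mem_union, Finset.mem_filter, Finset.mem_univ, true_and] at hv ⊢
  obtain ⟨w, hw⟩ := hv
  by_cases h : τ w < τ v ↔ τ' w < τ' v
  · exact Or.inr ⟨w, fun h' => hw (h.trans h')⟩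
  · exact Or.inl ⟨w, h⟩

theorem dOrd_self (τ : Equiv.Perm (Fin n)) (v : Fin n) : dOrd τ τ v = 0 := by simp [dOrd]

theorem dMov_self (τ : Equiv.Perm (Fin n)) : dMov τ τ = 0 := by simp [dMov]

theorem dOrd_eq_zero {τ τ' : Equiv.Perm (Fin n)} {v : Fin n} :
    dOrd τ τ' v = 0 ↔ ∀ w, τ w < τ v ↔ τ' w < τ' v := by
  simp only [dOrd, Finset.card_eq_zero, Finset.filter_eq_empty_iff, Finset.mem_univ,
    forall_const, not_not]

/-! ### Changes accumulated along a path of preference lists. -/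

/-- The sum of `f` over the steps of the path `π, tr`. -/
def pathSum (f : Prefs n → Prefs n → ℕ) : Prefs n → List (Prefs n) → ℕ
  | _, [] => 0
  | π, π' :: tr => f π π' + pathSum f π' tr

theorem pathSum_append (f : Prefs n → Prefs n → ℕ) (π : Prefs n) (tr tr' : List (Prefs n)) :
    pathSum f π (tr ++ tr') = pathSum f π tr + pathSum f (tr.getLastD π) tr' := by
  induction tr generalizing π with
  | nil => simp [pathSum]
  | cons π' tr ih =>
    simp only [List.cons_append, pathSum, ih, List.getLastD_cons, Nat.add_assoc]

theorem le_pathSum {f : Prefs n → Prefs n → ℕ} (h0 : ∀ π, f π π = 0)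
    (ht : ∀ π π' π'', f π π'' ≤ f π π' + f π' π'') (π : Prefs n) (tr : List (Prefs n)) :
    f π (tr.getLastD π) ≤ pathSum f π tr := by
  induction tr generalizing π with
  | nil => simp [h0]
  | cons π' tr ih =>
    rw [List.getLastD_cons]
    exact (ht π π' _).trans (Nat.add_le_add_left (ih π') _)

theorem dOrd_getLastD_le (z : Player n) (v : Fin n) (π : Prefs n) (tr : List (Prefs n)) :
    dOrd (π z) (tr.getLastD π z) v ≤ pathSum (fun π π' => dOrd (π z) (π' z) v) π tr :=
  le_pathSum (f := fun π π' => dOrd (π z) (π' z) v) (fun _ => dOrd_self _ _)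
    (fun _ _ _ => dOrd_triangle _ _ _ _) π tr

/-- The order of `u` relative to the other elements of the list of `z` is constant along the
path `π, tr`. -/
def Stable (z : Player n) (u : Fin n) (π : Prefs n) (tr : List (Prefs n)) : Prop :=
  ∀ π' ∈ tr, ∀ v, π' z v < π' z u ↔ π z v < π z u

-- An element that is not stable is counted by `dMov` in the step in which its order first changes.
open Classical in
theorem card_not_stable_le (z : Player n) (π : Prefs n) (tr : List (Prefs n)) :
    (Finset.univ.filter fun u => ¬ Stable z u π tr).card ≤
      pathSum (fun π π' => dMov (π z) (π' z)) π tr := by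
  induction tr generalizing π with
  | nil => simp [Stable]
  | cons π' tr ih =>
    refine le_trans (le_trans (Finset.card_le_card fun u hu => ?_) (Finset.card_union_le _ _))
      (Nat.add_le_add_left (ih π') _)
    simp only [Finset.mem_union, Finset.mem_filter, Finset.mem_univ, true_and] at hu ⊢
    by_contra hcon
    push Not at hcon
    obtain ⟨h1, h2⟩ := hcon
    refine hu fun π'' hπ'' v => ?_
    rcases List.mem_cons.1 hπ'' with rfl | h
    · exact (h1 v).symm
    · exact (h2 π'' h v).trans (h1 v).symm

/-! ### Correctness of the sorting -/

theorem mem_support_run_bind {α : ℕ} {X Y : Type} {a : QueryAlg n X} {g : X → QueryAlg n Y}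
    {π : Prefs n} {q : Y × List (Prefs n)} :
    q ∈ (run α (a.bind g) π).support ↔ ∃ r ∈ (run α a π).support,
      ∃ s ∈ (run α (g r.1) (r.2.getLastD π)).support, (s.1, r.2 ++ s.2) = q := by
  rw [run_bind]
  simp only [PMF.mem_support_bind_iff, PMF.mem_support_map_iff]

theorem mem_support_run_query {α : ℕ} {X : Type} {z : Player n} {u v : Fin n}
    {k : Bool → QueryAlg n X} {π : Prefs n} {q : X × List (Prefs n)} :
    q ∈ (run α (.query z u v k) π).support ↔ ∃ π' ∈ (evolve α π).support,
      ∃ s ∈ (run α (k (decide (π z u < π z v))) π').support, (s.1, π' :: s.2) = q := by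
  simp only [run, PMF.mem_support_bind_iff, PMF.mem_support_map_iff]

/-- Each element was compared with the pivot at its own time, so different elements may refer to
different lists of the trace. Nothing more about the answers is used for correctness. -/
theorem partition_sound {α : ℕ} {z : Player n} {p : Fin n} {l : List (Fin n)} {π : Prefs n}
    {r : {q : List (Fin n) × List (Fin n) // List.Perm (q.1 ++ q.2) l} × List (Prefs n)}
    (h : r ∈ (run α (partition z p l) π).support) :
    (∀ v ∈ r.1.1.1, ∃ π' ∈ π :: r.2, π' z v < π' z p) ∧
      ∀ v ∈ r.1.1.2, ∃ π' ∈ π :: r.2, ¬ π' z v < π' z p := by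
  induction l generalizing π with
  | nil =>
    simp only [partition, run, PMF.mem_support_pure_iff] at h
    simp [h]
  | cons u l ih =>
    simp only [partition] at h
    obtain ⟨π', -, s, hs, rfl⟩ := mem_support_run_query.1 h
    rw [run_bind_ret, PMF.mem_support_map_iff] at hs
    obtain ⟨q, hq, rfl⟩ := hs
    obtain ⟨h1, h2⟩ := ih hq
    have e1 : ∀ v ∈ q.1.1.1, ∃ π'' ∈ π :: π' :: q.2, π'' z v < π'' z p := fun v hv => by
      obtain ⟨π'', hm, hlt⟩ := h1 v hv
      exact ⟨π'', List.mem_cons_of_mem _ hm, hlt⟩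
    have e2 : ∀ v ∈ q.1.1.2, ∃ π'' ∈ π :: π' :: q.2, ¬ π'' z v < π'' z p := fun v hv => by
      obtain ⟨π'', hm, hlt⟩ := h2 v hv
      exact ⟨π'', List.mem_cons_of_mem _ hm, hlt⟩
    by_cases hc : π z u < π z p
    · simp only [hc, decide_true]
      refine ⟨fun v hv => ?_, e2⟩
      rcases List.mem_cons.1 hv with rfl | hv
      · exact ⟨π, List.mem_cons_self, hc⟩
      · exact e1 v hv
    · simp only [hc, decide_false]
      refine ⟨e1, fun v hv => ?_⟩
      rcases List.mem_cons.1 hv with rfl | hv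
      · exact ⟨π, List.mem_cons_self, hc⟩
      · exact e2 v hv

theorem getLastD_append {X : Type*} (s t : List X) (a : X) :
    (s ++ t).getLastD a = t.getLastD (s.getLastD a) := by
  induction s generalizing a with
  | nil => rfl
  | cons b s ih => rw [List.cons_append, List.getLastD_cons, List.getLastD_cons, ih]

theorem mem_cons_append_of_mem_getLastD {X : Type*} {π π' : X} {s t : List X}
    (h : π' ∈ s.getLastD π :: t) : π' ∈ π :: (s ++ t) := by
  rcases List.mem_cons.1 h with rfl | h
  · rcases List.mem_cons.1 (List.getLastD_mem_cons (l := s) (a := π)) with h | h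
    · rw [h]; exact List.mem_cons_self
    · exact List.mem_cons_of_mem _ (List.mem_append_left _ h)
  · exact List.mem_cons_of_mem _ (List.mem_append_right _ h)

/-- If the set `L` of elements before `u` is constant during the sorting, then these are the
elements before `u` in the result. -/
theorem quicksort_split {α : ℕ} {z : Player n} {u : Fin n} {L : Set (Fin n)} (m : ℕ)
    {l : List (Fin n)} (hl : l.length ≤ m) {π : Prefs n}
    {r : {l' : List (Fin n) // List.Perm l' l} × List (Prefs n)}
    (h : r ∈ (run α (quicksort z l) π).support) (hu : u ∈ l)
    (hL : ∀ π' ∈ π :: r.2, ∀ v, π' z v < π' z u ↔ v ∈ L) :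
    ∃ r₁ r₂, r.1.1 = r₁ ++ u :: r₂ ∧ (∀ v ∈ r₁, v ∈ L) ∧ ∀ v ∈ r₂, v ∉ L := by
  induction m generalizing l π with
  | zero => simp_all
  | succ m ih =>
    cases l with
    | nil => simp at hu
    | cons a as =>
      rw [quicksort] at h
      simp only [run, PMF.mem_support_bind_iff] at h
      obtain ⟨i, -, h⟩ := h
      obtain ⟨q, hq, s, hs, rfl⟩ := mem_support_run_bind.1 h
      obtain ⟨lo, hlo, s', hs', rfl⟩ := mem_support_run_bind.1 hs
      rw [run_bind_ret, PMF.mem_support_map_iff] at hs'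
      obtain ⟨hi, hhi, rfl⟩ := hs'
      dsimp only at hL ⊢
      obtain ⟨p1, p2⟩ := partition_sound hq
      have hlen := q.1.2.length_eq
      rw [List.length_append, List.length_eraseIdx_of_lt i.isLt] at hlen
      simp only [List.length_cons] at hlen hl
      generalize hp : (a :: as)[i] = p at p1 p2 ⊢
      have hmem : u = p ∨ u ∈ q.1.1.1 ∨ u ∈ q.1.1.2 := by
        have := ((List.getElem_cons_eraseIdx_perm (l := a :: as) i.isLt).mem_iff (a := u)).2 hu
        rw [List.mem_cons, ← q.1.2.mem_iff, List.mem_append] at this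
        rcases this with h | h
        · exact Or.inl (h.trans hp)
        · exact Or.inr h
      have sub1 : ∀ π' ∈ π :: q.2, π' ∈ π :: (q.2 ++ (lo.2 ++ hi.2)) := fun π' h => by
        rw [List.mem_cons] at h ⊢; rw [List.mem_append]; tauto
      have sub2 : ∀ π' ∈ q.2.getLastD π :: lo.2, π' ∈ π :: (q.2 ++ (lo.2 ++ hi.2)) :=
        fun π' h => mem_cons_append_of_mem_getLastD (by
          rw [List.mem_cons] at h ⊢; rw [List.mem_append]; tauto)
      have sub3 : ∀ π' ∈ lo.2.getLastD (q.2.getLastD π) :: hi.2,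
          π' ∈ π :: (q.2 ++ (lo.2 ++ hi.2)) :=
        fun π' h => mem_cons_append_of_mem_getLastD (mem_cons_append_of_mem_getLastD h)
      -- A comparison of `v` with the pivot at a single time becomes one of `v` with `u`, because
      -- the pivot is on the same side of `u` at all times, and so is `v`.
      have hlow : p ∈ L ∨ p = u → ∀ v ∈ q.1.1.1, v ∈ L := fun hpL v hv => by
        obtain ⟨π', hm, hlt⟩ := p1 v hv
        rw [← hL π' (sub1 π' hm)]
        rcases hpL with hpL | rfl
        · exact hlt.trans ((hL π' (sub1 π' hm) p).2 hpL)
        · exact hlt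
      have hhigh : p ∉ L → ∀ v ∈ q.1.1.2, v ∉ L := fun hpL v hv => by
        obtain ⟨π', hm, hlt⟩ := p2 v hv
        rw [← hL π' (sub1 π' hm)] at hpL ⊢
        exact not_lt.2 ((not_lt.1 hpL).trans (not_lt.1 hlt))
      have huL : u ∉ L := by
        rw [← hL π List.mem_cons_self]; exact lt_irrefl _
      have mlo : ∀ v ∈ lo.1.1, v ∈ q.1.1.1 := fun v hv => lo.1.2.mem_iff.1 hv
      have mhi : ∀ v ∈ hi.1.1, v ∈ q.1.1.2 := fun v hv => hi.1.2.mem_iff.1 hv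
      by_cases hpu : p = u
      · refine ⟨lo.1.1, hi.1.1, by rw [hpu], fun v hv => hlow (Or.inr hpu) v (mlo v hv),
          fun v hv => hhigh (hpu ▸ huL) v (mhi v hv)⟩
      by_cases hpL : p ∈ L
      · have hu' : u ∈ q.1.1.2 := by
          rcases hmem with h | h | h
          · exact absurd h.symm hpu
          · exact absurd (hlow (Or.inl hpL) u h) huL
          · exact h
        obtain ⟨r₁, r₂, e, h1, h2⟩ := ih (by omega) hhi hu' fun π' h => hL π' (sub3 π' h)
        refine ⟨lo.1.1 ++ p :: r₁, r₂, by simp [e], fun v hv => ?_, h2⟩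
        rw [List.mem_append, List.mem_cons] at hv
        rcases hv with hv | rfl | hv
        · exact hlow (Or.inl hpL) v (mlo v hv)
        · exact hpL
        · exact h1 v hv
      · have hu' : u ∈ q.1.1.1 := by
          rcases hmem with h | h | h
          · exact absurd h.symm hpu
          · exact h
          · exfalso
            obtain ⟨π', hm, hlt⟩ := p2 u h
            rw [← hL π' (sub1 π' hm)] at hpL
            exact hpu ((π' z).injective (le_antisymm (not_lt.1 hlt) (not_lt.1 hpL)))
        obtain ⟨r₁, r₂, e, h1, h2⟩ := ih (by omega) hlo hu' fun π' h => hL π' (sub2 π' h)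
        refine ⟨r₁, r₂ ++ p :: hi.1.1, by simp [e], h1, fun v hv => ?_⟩
        rw [List.mem_append, List.mem_cons] at hv
        rcases hv with hv | rfl | hv
        · exact h2 v hv
        · exact hpL
        · exact hhigh hpL v (mhi v hv)

theorem toPerm_apply (l : Ranking n) (v : Fin n) :
    (Ranking.toPerm l v : ℕ) = l.1.idxOf v := by
  rfl

theorem toPerm_lt_iff {l : Ranking n} {u : Fin n} {L : Set (Fin n)} {r₁ r₂ : List (Fin n)}
    (e : l.1 = r₁ ++ u :: r₂) (h1 : ∀ v ∈ r₁, v ∈ L) (h2 : ∀ v ∈ r₂, v ∉ L) (huL : u ∉ L)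
    (v : Fin n) : Ranking.toPerm l v < Ranking.toPerm l u ↔ v ∈ L := by
  rw [Fin.lt_def, toPerm_apply, toPerm_apply, e]
  have hu1 : u ∉ r₁ := fun h => huL (h1 u h)
  have hu : (r₁ ++ u :: r₂).idxOf u = r₁.length := by
    rw [List.idxOf_append_of_notMem hu1]; simp
  rw [hu]
  have hv : v ∈ r₁ ++ u :: r₂ := e ▸ l.2.mem_iff.2 (List.mem_finRange v)
  by_cases hv1 : v ∈ r₁
  · rw [List.idxOf_append_of_mem hv1]
    exact ⟨fun _ => h1 v hv1, fun _ => List.idxOf_lt_length_iff.2 hv1⟩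
  · rw [List.idxOf_append_of_notMem hv1]
    refine ⟨fun h => absurd h (by omega), fun h => absurd h ?_⟩
    rw [List.mem_append, List.mem_cons] at hv
    rcases hv with hv | rfl | hv
    · exact absurd hv hv1
    · exact huL
    · exact h2 v hv

/-- Only `w` has to be stable, not `v`: `quicksort_split` at a stable `w` places every `v` on the
correct side of `w`. Hence every `w` counted on the left is unstable, whatever `v` does. -/
theorem dOrd_quicksort_le {α : ℕ} {z : Player n} {π : Prefs n}
    {r : Ranking n × List (Prefs n)}
    (h : r ∈ (run α (quicksort z (List.finRange n)) π).support) (v : Fin n) :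
    dOrd (Ranking.toPerm r.1) (r.2.getLastD π z) v ≤
      pathSum (fun π π' => dMov (π z) (π' z)) π r.2 := by
  classical
  refine le_trans (Finset.card_le_card fun w hw => ?_) (card_not_stable_le z π r.2)
  simp only [Finset.mem_filter, Finset.mem_univ, true_and] at hw ⊢
  intro hst
  have hL : ∀ π' ∈ π :: r.2, ∀ v, π' z v < π' z w ↔ v ∈ {v | π z v < π z w} := by
    intro π' hπ' v
    rcases List.mem_cons.1 hπ' with rfl | hπ'
    · rfl
    · exact hst π' hπ' v
  obtain ⟨r₁, r₂, e, h1, h2⟩ :=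
    quicksort_split _ (le_refl _) h (List.mem_finRange w) hL
  have key : Ranking.toPerm r.1 v < Ranking.toPerm r.1 w ↔
      r.2.getLastD π z v < r.2.getLastD π z w :=
    (toPerm_lt_iff e h1 h2 (by simp) v).trans (hL _ (List.getLastD_mem_cons) v).symm
  apply hw
  by_cases hvw : w = v
  · simp [hvw]
  · have flip : ∀ τ : Equiv.Perm (Fin n), τ w < τ v ↔ ¬ τ v < τ w := fun τ =>
      ⟨fun h => not_lt.2 h.le, fun h => lt_of_le_of_ne (not_lt.1 h) fun h => hvw (τ.injective h)⟩
    rw [flip, flip, key]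

theorem sequentialSort_of_notMem {α : ℕ} {zs : List (Player n)} {acc : Prefs n} {π : Prefs n}
    {r : Prefs n × List (Prefs n)} (h : r ∈ (run α (sequentialSort zs acc) π).support)
    {z : Player n} (hz : z ∉ zs) : r.1 z = acc z := by
  induction zs generalizing acc π r with
  | nil =>
    simp only [sequentialSort, run, PMF.mem_support_pure_iff] at h
    rw [h]
  | cons z' zs ih =>
    rw [sequentialSort] at h
    obtain ⟨q, -, s, hs, rfl⟩ := mem_support_run_bind.1 h
    rw [List.mem_cons, not_or] at hz
    rw [ih hs hz.2, Function.update_of_ne hz.1]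

/-- If during each single sort few elements of the list being sorted move, except with
probability `δ`, then the sorted lists differ little from the actual ones. -/
theorem prob_sequentialSort_le {α m : ℕ} {δ : ℝ≥0∞}
    (hδ : ∀ (z : Player n) (π : Prefs n), prob (run α (quicksort z (List.finRange n)) π)
      (fun r => m < pathSum (fun π π' => dMov (π z) (π' z)) π r.2) ≤ δ)
    {zs : List (Player n)} (hzs : zs.Nodup) (acc π : Prefs n) :
    prob (run α (sequentialSort zs acc) π) (fun r => ∃ z ∈ zs, ∃ v,
      m + pathSum (fun π π' => dOrd (π z) (π' z) v) π r.2 <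
        dOrd (r.1 z) (r.2.getLastD π z) v) ≤ zs.length * δ := by
  induction zs generalizing acc π with
  | nil => simp [prob, ex]
  | cons z zs ih =>
    rw [List.nodup_cons] at hzs
    rw [sequentialSort, run_bind]
    have hcast : (((z :: zs).length : ℕ) : ℝ≥0∞) * δ = δ + zs.length * δ := by
      simp only [List.length_cons]; push_cast; ring
    rw [hcast]
    refine le_trans (prob_bind_le
      (Q := fun r => m < pathSum (fun π π' => dMov (π z) (π' z)) π r.2) ?_)
      (add_le_add_left (hδ z π) _)
    intro r hr hQ
    rw [prob_map]
    refine le_trans (prob_mono_support ?_) (ih hzs.2 (Function.update acc z (Ranking.toPerm r.1))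
      (r.2.getLastD π))
    rintro q hq ⟨z', hz', v, hv⟩
    rw [pathSum_append] at hv
    have hlast : (r.2 ++ q.2).getLastD π = q.2.getLastD (r.2.getLastD π) := by
      exact getLastD_append _ _ _
    simp only [hlast] at hv
    rcases List.mem_cons.1 hz' with rfl | hz'
    · exfalso
      -- No later sort overwrites this list, so its discrepancy is the error of its own sort plus
      -- the drift since the end of that sort.
      rw [sequentialSort_of_notMem hq hzs.1, Function.update_self] at hv
      have h1 := dOrd_quicksort_le hr v
      have h2 := dOrd_triangle (Ranking.toPerm r.1) (r.2.getLastD π z')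
        (q.2.getLastD (r.2.getLastD π) z') v
      have h3 := dOrd_getLastD_le z' v (r.2.getLastD π) q.2
      omega
    · exact ⟨z', hz', v, by omega⟩

/-! ### Stability -/

/-- Further invariants of the Gale–Shapley algorithm: a partner is the last one proposed to, and
whoever received a proposal has a partner that is at least as good. -/
structure GSState.StableInv (σ : Prefs n) (s : GSState n) : Prop where
  last : ∀ x y, s.partner y = some x → (σ (Sum.inl x) y : ℕ) < s.proposals x ∧
    ∀ y', (σ (Sum.inl x) y' : ℕ) < s.proposals x → σ (Sum.inl x) y' ≤ σ (Sum.inl x) y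
  better : ∀ x y, (σ (Sum.inl x) y : ℕ) < s.proposals x →
    ∃ x', s.partner y = some x' ∧ σ (Sum.inr y) x' ≤ σ (Sum.inr y) x

/-- Members of `A` propose in descending order of preference, so the latest proposal is the worst
one; members of `B` change partners only for better ones. -/
theorem gsStep_stableInv {σ : Prefs n} {s : GSState n} (h : s.StableInv σ) :
    (gsStep σ s).StableInv σ := by
  unfold gsStep
  split
  · exact h
  rename_i x hx
  have hfree := GSState.firstFree_some hx
  split_ifs with hlt
  swap
  · exact h
  set y₀ := (σ (Sum.inl x)).symm ⟨s.proposals x, hlt⟩ with hy₀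
  have hσ : σ (Sum.inl x) y₀ = ⟨s.proposals x, hlt⟩ := by rw [hy₀, Equiv.apply_symm_apply]
  have hlt' : ∀ y, (σ (Sum.inl x) y : ℕ) < s.proposals x + 1 →
      (σ (Sum.inl x) y : ℕ) < s.proposals x ∨ y = y₀ := fun y hy => by
    rcases Nat.lt_succ_iff_lt_or_eq.1 hy with h1 | h1
    · exact Or.inl h1
    · exact Or.inr ((σ (Sum.inl x)).injective (by rw [hσ]; exact Fin.ext h1))
  constructor
  · intro w y hw
    dsimp only at hw ⊢
    by_cases hwx : w = x
    · subst hwx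
      rw [Function.update_self]
      have hy : y = y₀ := by
        split_ifs at hw with hacc
        · rw [Function.update_apply] at hw
          split_ifs at hw with e
          · exact e
          · exact absurd hw (hfree y)
        · exact absurd hw (hfree y)
      rw [hy, hσ]
      exact ⟨by simp, fun y' hy' => Fin.le_def.2 (by simpa [Nat.lt_succ_iff] using hy')⟩
    · rw [Function.update_of_ne hwx]
      apply h.last
      split_ifs at hw with hacc
      · rw [Function.update_apply] at hw
        split_ifs at hw with e
        · exact absurd (Option.some.inj hw).symm hwx
        · exact hw
      · exact hw
  · intro w y hw
    dsimp only at hw ⊢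
    have key : (∃ x', s.partner y = some x' ∧ σ (Sum.inr y) x' ≤ σ (Sum.inr y) w) ∨
        (w = x ∧ y = y₀) := by
      by_cases hwx : w = x
      · subst hwx
        rw [Function.update_self] at hw
        rcases hlt' y hw with h1 | h1
        · exact Or.inl (h.better w y h1)
        · exact Or.inr ⟨rfl, h1⟩
      · rw [Function.update_of_ne hwx] at hw
        exact Or.inl (h.better w y hw)
    split_ifs with hacc
    · by_cases hy : y = y₀
      · subst hy
        refine ⟨x, Function.update_self _ _ _, ?_⟩
        rcases key with ⟨x', hx', hle⟩ | ⟨rfl, -⟩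
        · simp only [GSState.accepts, hx', decide_eq_true_eq] at hacc
          exact hacc.le.trans hle
        · exact le_rfl
      · rw [Function.update_of_ne hy]
        exact key.resolve_right fun h => hy h.2
    · rcases key with k | ⟨rfl, rfl⟩
      · exact k
      · cases hp : s.partner y₀ with
        | none => simp [GSState.accepts, hp] at hacc
        | some x' =>
          simp only [GSState.accepts, hp, decide_eq_true_eq, not_lt] at hacc
          exact ⟨x', rfl, hacc⟩

theorem gsFinal_stableInv (σ : Prefs n) : (gsFinal σ).StableInv σ := by
  have : ∀ k, ((gsStep σ)^[k] (GSState.init n)).StableInv σ := fun k => by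
    induction k with
    | zero => exact ⟨by simp [GSState.init], by simp [GSState.init]⟩
    | succ k ih => rw [Function.iterate_succ_apply']; exact gsStep_stableInv ih
  exact this _

/-- The Gale–Shapley matching has no blocking pair. -/
theorem galeShapley_stable (σ : Prefs n) (x y : Fin n) : ¬ IsBlocking σ (galeShapley σ) x y := by
  rintro ⟨h1, h2⟩
  have hM : ∀ x, (gsFinal σ).partner (galeShapley σ x) = some x := (gsFinal_perfect σ).choose_spec
  have inv := gsFinal_stableInv σ
  obtain ⟨hlt, -⟩ := inv.last x _ (hM x)
  -- Since `x` prefers `y` to its partner, it has proposed to `y` before, so `y` ends with someone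
  -- at least as good as `x`.
  obtain ⟨x', hx', hle⟩ := inv.better x y (lt_trans (Fin.lt_def.1 h1) hlt)
  have := hM ((galeShapley σ).symm y)
  rw [Equiv.apply_symm_apply, hx', Option.some.injEq] at this
  exact absurd h2 (not_lt.2 (this ▸ hle))

/-- Every blocking pair involves a change of order relative to a partner. -/
theorem numBlocking_galeShapley_le (σ π : Prefs n) {b : ℕ}
    (h : ∀ z v, dOrd (σ z) (π z) v ≤ b) : numBlocking π (galeShapley σ) ≤ 2 * n * b := by
  classical
  set M := galeShapley σ
  let S₁ : Finset (Fin n × Fin n) := Finset.univ.filter fun p =>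
    ¬(σ (Sum.inl p.1) p.2 < σ (Sum.inl p.1) (M p.1) ↔ π (Sum.inl p.1) p.2 < π (Sum.inl p.1) (M p.1))
  let S₂ : Finset (Fin n × Fin n) := Finset.univ.filter fun p =>
    ¬(σ (Sum.inr p.2) p.1 < σ (Sum.inr p.2) (M.symm p.2) ↔
      π (Sum.inr p.2) p.1 < π (Sum.inr p.2) (M.symm p.2))
  have hsub : {p : Fin n × Fin n | IsBlocking π M p.1 p.2} ⊆ ((S₁ ∪ S₂ : Finset _) : Set _) := by
    rintro p ⟨h1, h2⟩
    have hst := galeShapley_stable σ p.1 p.2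
    simp only [IsBlocking, not_and_or] at hst
    simp only [S₁, S₂, Finset.coe_union, Set.mem_union, Finset.mem_coe, Finset.mem_filter,
      Finset.mem_univ, true_and]
    rcases hst with hst | hst
    · exact Or.inl fun h => hst (h.2 h1)
    · exact Or.inr fun h => hst (h.2 h2)
  have hS₁ : S₁.card ≤ n * b := by
    have := Finset.card_le_mul_card_image_of_maps_to (s := S₁) (t := Finset.univ) (f := Prod.fst)
      (fun _ _ => Finset.mem_univ _) b fun x _ => by
        -- For fixed `x` the reference element `M x` is fixed too, so a single `dOrd` bounds the
        -- number of such `y`.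
        refine le_trans ?_ (h (Sum.inl x) (M x))
        refine Finset.card_le_card_of_injOn Prod.snd ?_ ?_
        · rintro ⟨x', y⟩ hp
          simp only [S₁, Finset.coe_filter, Finset.mem_filter, Finset.mem_univ, true_and,
            Set.mem_ofPred_eq] at hp ⊢
          obtain ⟨hp, rfl⟩ := hp
          exact hp
        · rintro ⟨x', y⟩ hp ⟨x'', y'⟩ hp' e
          simp only [Finset.coe_filter, Set.mem_ofPred_eq] at hp hp' e
          rw [hp.2, hp'.2, e]
    simpa [mul_comm] using this
  have hS₂ : S₂.card ≤ n * b := by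
    have := Finset.card_le_mul_card_image_of_maps_to (s := S₂) (t := Finset.univ) (f := Prod.snd)
      (fun _ _ => Finset.mem_univ _) b fun y _ => by
        refine le_trans ?_ (h (Sum.inr y) (M.symm y))
        refine Finset.card_le_card_of_injOn Prod.fst ?_ ?_
        · rintro ⟨x, y'⟩ hp
          simp only [S₂, Finset.coe_filter, Finset.mem_filter, Finset.mem_univ, true_and,
            Set.mem_ofPred_eq] at hp ⊢
          obtain ⟨hp, rfl⟩ := hp
          exact hp
        · rintro ⟨x, y'⟩ hp ⟨x', y''⟩ hp' e
          simp only [Finset.coe_filter, Set.mem_ofPred_eq] at hp hp' e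
          rw [hp.2, hp'.2, e]
    simpa [mul_comm] using this
  calc numBlocking π M ≤ Set.ncard ((S₁ ∪ S₂ : Finset _) : Set _) :=
        Set.ncard_le_ncard hsub (Finset.finite_toSet _)
    _ = (S₁ ∪ S₂).card := Set.ncard_coe_finset _
    _ ≤ S₁.card + S₂.card := Finset.card_union_le _ _
    _ ≤ 2 * n * b := by linarith [mul_assoc 2 n b]

theorem numBlocking_le (π : Prefs n) (M : Matching n) : numBlocking π M ≤ n * n := by
  calc numBlocking π M ≤ Set.ncard (Set.univ : Set (Fin n × Fin n)) :=
        Set.ncard_le_ncard (Set.subset_univ _)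
    _ = n * n := by simp [Set.ncard_univ]

/-! ### Exponential moments of additive functionals of the evolution -/

theorem swap_lt_swap_iff {i j : Fin n} (hij : (j : ℕ) = i + 1) (a b : Fin n)
    (h : ¬(a < b ↔ Equiv.swap i j a < Equiv.swap i j b)) :
    (a = i ∧ b = j) ∨ (a = j ∧ b = i) := by
  simp only [Equiv.swap_apply_def] at h
  simp only [Fin.ext_iff, Fin.lt_def] at h ⊢
  split_ifs at h <;> omega

theorem dOrd_swap_le {i j : Fin n} (hij : (j : ℕ) = i + 1) (τ : Equiv.Perm (Fin n)) (v : Fin n) :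
    dOrd τ (τ.trans (Equiv.swap i j)) v ≤ if τ v = i ∨ τ v = j then 1 else 0 := by
  have key : ∀ w, ¬(τ w < τ v ↔ τ.trans (Equiv.swap i j) w < τ.trans (Equiv.swap i j) v) →
      (τ w = i ∧ τ v = j) ∨ (τ w = j ∧ τ v = i) := fun w hw => swap_lt_swap_iff hij _ _ hw
  split_ifs with h
  · refine Finset.card_le_one.2 fun w hw w' hw' => ?_
    simp only [Finset.mem_filter, Finset.mem_univ, true_and] at hw hw'
    have hne : i ≠ j := fun e => by rw [e] at hij; omega
    apply τ.injective
    rcases key w hw with ⟨h1, h2⟩ | ⟨h1, h2⟩ <;> rcases key w' hw' with ⟨h3, h4⟩ | ⟨h3, h4⟩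
    · rw [h1, h3]
    · exact absurd (h4.symm.trans h2) hne
    · exact absurd (h2.symm.trans h4) hne
    · rw [h1, h3]
  · rw [Nat.le_zero, dOrd_eq_zero]
    intro w
    by_contra hw
    rcases key w hw with ⟨h1, h2⟩ | ⟨h1, h2⟩
    · exact h (Or.inr h2)
    · exact h (Or.inl h2)

theorem dMov_swap_le {i j : Fin n} (hij : (j : ℕ) = i + 1) (τ : Equiv.Perm (Fin n)) :
    dMov τ (τ.trans (Equiv.swap i j)) ≤ 2 := by
  refine (Finset.card_le_card fun v hv => ?_).trans
    (Finset.card_le_two (a := τ.symm i) (b := τ.symm j))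
  simp only [Finset.mem_filter, Finset.mem_univ, true_and] at hv
  obtain ⟨w, hw⟩ := hv
  rw [Finset.mem_insert, Finset.mem_singleton, Equiv.eq_symm_apply, Equiv.eq_symm_apply]
  rcases swap_lt_swap_iff hij _ _ hw with h | h
  · exact Or.inr h.2
  · exact Or.inl h.2

/-- If only few of the possible events change `f`, then `2 ^ f` is small on average. -/
theorem ex_evolveOnce_le (hn : 2 ≤ n) {f : Prefs n → Prefs n → ℕ} {D : ℕ} {κ : ℝ} {π : Prefs n}
    (S : Finset (Player n × Fin (n - 1)))
    (hS : ∀ e, 2 ^ f π (swapEvent π e.1 e.2) ≤ 1 + if e ∈ S then D else 0)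
    (hκ : (D : ℝ) * S.card ≤ κ * (2 * n * (n - 1))) :
    ex (evolveOnce π) (fun π' => 2 ^ f π π') ≤ ENNReal.ofReal (Real.exp κ) := by
  classical
  have hne : Nonempty (Player n × Fin (n - 1)) :=
    ⟨(Sum.inl ⟨0, by omega⟩, ⟨0, by omega⟩)⟩
  have hcard : Fintype.card (Player n × Fin (n - 1)) = 2 * n * (n - 1) := by
    simp only [Fintype.card_prod, Fintype.card_sum, Fintype.card_fin]; ring
  have hpos : 0 < 2 * n * (n - 1) := Nat.mul_pos (by omega) (by omega)
  have hsum : ∑ e : Player n × Fin (n - 1), 2 ^ f π (swapEvent π e.1 e.2) ≤ 2 * n * (n - 1) + D * S.card := by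
    refine (Finset.sum_le_sum fun e _ => hS e).trans_eq ?_
    rw [Finset.sum_add_distrib, Finset.sum_ite_mem, Finset.univ_inter]
    simp only [Finset.sum_const, Finset.card_univ, hcard, smul_eq_mul, mul_one]
    ring
  rw [evolveOnce, dif_pos hne, ex_map, ex_uniform, hcard]
  have hcast : ∑ e : Player n × Fin (n - 1), (2 : ℝ≥0∞) ^ f π (swapEvent π e.1 e.2) =
      ((∑ e : Player n × Fin (n - 1), 2 ^ f π (swapEvent π e.1 e.2) : ℕ) : ℝ≥0∞) := by push_cast; rfl
  rw [hcast, ← ENNReal.div_eq_inv_mul]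
  refine ENNReal.div_le_of_le_mul ?_
  rw [← ENNReal.ofReal_natCast, ← ENNReal.ofReal_natCast, ← ENNReal.ofReal_mul (Real.exp_pos _).le]
  refine ENNReal.ofReal_le_ofReal ?_
  have h1 : ((∑ e : Player n × Fin (n - 1), 2 ^ f π (swapEvent π e.1 e.2) : ℕ) : ℝ) ≤
      (2 * n * (n - 1) : ℕ) + D * S.card := by exact_mod_cast hsum
  have h2 : ((2 * n * (n - 1) : ℕ) : ℝ) = 2 * n * (n - 1) := by
    push_cast [Nat.cast_sub (show 1 ≤ n by omega)]; ring
  have h3 : (0 : ℝ) < (2 * n * (n - 1) : ℕ) := by exact_mod_cast hpos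
  rw [h2] at h1 h3 ⊢
  -- The mean is at most 1 + D|S|/(2n(n-1)) ≤ 1 + κ ≤ exp κ.
  nlinarith [Real.add_one_le_exp κ]

theorem ex_evolveOnce_dOrd_le (hn : 2 ≤ n) (z : Player n) (v : Fin n) (π : Prefs n) :
    ex (evolveOnce π) (fun π' => 2 ^ dOrd (π z) (π' z) v) ≤
      ENNReal.ofReal (Real.exp (2 / n ^ 2)) := by
  classical
  let S : Finset (Player n × Fin (n - 1)) := Finset.univ.filter fun e =>
    e.1 = z ∧ ((e.2 : ℕ) = π z v ∨ (e.2 : ℕ) + 1 = π z v)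
  -- A swap changes at most one order relative to `v`, and 2¹ = 1 + 1; only the two swaps that
  -- involve the rank of `v` count.
  refine ex_evolveOnce_le (f := fun π π' => dOrd (π z) (π' z) v) hn (D := 1) S (fun e => ?_) ?_
  · obtain ⟨z', i⟩ := e
    by_cases hz : z' = z
    · subst hz
      have := dOrd_swap_le (n := n) (i := ⟨i, by have := i.isLt; omega⟩)
        (j := ⟨i + 1, by have := i.isLt; omega⟩) rfl (π z') v
      simp only [swapEvent, Function.update_self]
      generalize dOrd _ _ _ = d at this ⊢
      have hmem : (z', i) ∈ S ↔ (π z' v = ⟨i, by have := i.isLt; omega⟩ ∨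
          π z' v = ⟨i + 1, by have := i.isLt; omega⟩) := by
        simp only [S, Finset.mem_filter, Finset.mem_univ, true_and, Fin.ext_iff, eq_comm]
      rw [if_congr hmem rfl rfl]
      split_ifs at this ⊢
      · interval_cases d <;> norm_num
      · interval_cases d; norm_num
    · simp only [swapEvent, Function.update_of_ne (Ne.symm hz), dOrd_self]
      simp
  · have hS : S.card ≤ 2 := by
      have : S.card ≤ (({(π z v : ℕ), (π z v : ℕ) - 1} : Finset ℕ)).card := by
        refine Finset.card_le_card_of_injOn (fun e => (e.2 : ℕ)) ?_ ?_
        · intro e he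
          simp only [S, Finset.coe_filter, Finset.mem_univ, true_and, Set.mem_ofPred_eq] at he
          simp only [Finset.coe_insert, Finset.coe_singleton, Set.mem_insert_iff,
            Set.mem_singleton_iff]
          omega
        · intro e he e' he' h
          simp only [S, Finset.coe_filter, Finset.mem_univ, true_and, Set.mem_ofPred_eq] at he he'
          exact Prod.ext (he.1.trans he'.1.symm) (Fin.ext h)
      exact this.trans Finset.card_le_two
    have hn' : (2 : ℝ) ≤ n := by exact_mod_cast hn
    have hS' : (S.card : ℝ) ≤ 2 := by exact_mod_cast hS
    have : (2 : ℝ) / n ^ 2 * (2 * n * (n - 1)) = 4 - 4 / n := by field_simp; ring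
    have h4 : (4 : ℝ) / n ≤ 2 := by rw [div_le_iff₀ (by linarith)]; linarith
    rw [this]
    push_cast
    linarith

theorem ex_evolveOnce_dMov_le (hn : 2 ≤ n) (z : Player n) (π : Prefs n) :
    ex (evolveOnce π) (fun π' => 2 ^ dMov (π z) (π' z)) ≤ ENNReal.ofReal (Real.exp (2 / n)) := by
  classical
  let S : Finset (Player n × Fin (n - 1)) := {z} ×ˢ Finset.univ
  -- A swap moves at most two elements, and 2² = 1 + 3; all n - 1 swaps in the list of `z` count.
  refine ex_evolveOnce_le (f := fun π π' => dMov (π z) (π' z)) hn (D := 3) S (fun e => ?_) ?_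
  · obtain ⟨z', i⟩ := e
    by_cases hz : z' = z
    · subst hz
      have := dMov_swap_le (n := n) (i := ⟨i, by have := i.isLt; omega⟩)
        (j := ⟨i + 1, by have := i.isLt; omega⟩) rfl (π z')
      simp only [swapEvent, Function.update_self]
      generalize dMov _ _ = d at this ⊢
      rw [if_pos (by simp [S])]
      interval_cases d <;> norm_num
    · simp only [swapEvent, Function.update_of_ne (Ne.symm hz), dMov_self]
      simp
  · have hn' : (2 : ℝ) ≤ n := by exact_mod_cast hn
    have hS : (S.card : ℝ) = n - 1 := by
      simp [S, Nat.cast_sub (show 1 ≤ n by omega)]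
    have : (2 : ℝ) / n * (2 * n * (n - 1)) = 4 * (n - 1) := by field_simp; ring
    rw [this, hS]
    push_cast
    linarith

/-- By the triangle inequality `2 ^ f` is submultiplicative over consecutive events, and each event
contributes a factor exp κ whatever the current lists are. -/
theorem ex_evolve_le {f : Prefs n → Prefs n → ℕ} (h0 : ∀ π, f π π = 0)
    (ht : ∀ π π' π'', f π π'' ≤ f π π' + f π' π'') {κ : ℝ}
    (h : ∀ π, ex (evolveOnce π) (fun π' => 2 ^ f π π') ≤ ENNReal.ofReal (Real.exp κ))
    (k : ℕ) (π : Prefs n) :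
    ex (evolve k π) (fun π' => 2 ^ f π π') ≤ ENNReal.ofReal (Real.exp (k * κ)) := by
  induction k generalizing π with
  | zero => simp [evolve, ex_pure, h0]
  | succ k ih =>
    rw [evolve, ex_bind]
    calc ex (evolveOnce π) (fun π' => ex (evolve k π') fun π'' => 2 ^ f π π'')
        ≤ ex (evolveOnce π) (fun π' => 2 ^ f π π' * ENNReal.ofReal (Real.exp (k * κ))) := by
          refine ex_mono fun π' => ?_
          refine le_trans (ex_mono fun π'' => ?_)
            ((ex_const_mul _ _ _).trans_le (mul_le_mul_right (ih π') _))
          rw [← pow_add]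
          exact pow_le_pow_right₀ (by norm_num) (ht _ _ _)
      _ ≤ ENNReal.ofReal (Real.exp κ) * ENNReal.ofReal (Real.exp (k * κ)) := by
          rw [ex_mul_const]
          exact mul_le_mul_left (h π) _
      _ = ENNReal.ofReal (Real.exp ((k + 1 : ℕ) * κ)) := by
          rw [← ENNReal.ofReal_mul (Real.exp_pos _).le, ← Real.exp_add]
          push_cast; ring_nf

/-- The bound on one step holds for all current lists, so it survives any adaptive choice of queries
and the factors multiply. Truncation at `k` is needed because the number of steps is random; its
tail is treated separately. -/
theorem ex_run_take_le {α : ℕ} {f : Prefs n → Prefs n → ℕ} {κ : ℝ} (hκ : 0 ≤ κ)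
    (h : ∀ π, ex (evolve α π) (fun π' => 2 ^ f π π') ≤ ENNReal.ofReal (Real.exp κ))
    {X : Type} (a : QueryAlg n X) (k : ℕ) (π : Prefs n) :
    ex (run α a π) (fun r => 2 ^ pathSum f π (r.2.take k)) ≤
      ENNReal.ofReal (Real.exp (k * κ)) := by
  have h1 : ∀ k : ℕ, 1 ≤ ENNReal.ofReal (Real.exp (k * κ)) := fun k => by
    rw [ENNReal.one_le_ofReal]
    exact Real.one_le_exp (by positivity)
  induction a generalizing k π with
  | ret a => simpa [run, ex_pure, pathSum] using h1 k
  | rand m g ih =>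
    rw [run, ex_bind]
    exact ex_le fun i => ih i k π
  | query z u v g ih =>
    cases k with
    | zero => simp [pathSum, ex_const]
    | succ k =>
      rw [run, ex_bind]
      calc _ ≤ ex (evolve α π) (fun π' => 2 ^ f π π' * ENNReal.ofReal (Real.exp (k * κ))) := by
            refine ex_mono fun π' => ?_
            rw [ex_map]
            simp only [List.take_succ_cons, pathSum, pow_add]
            rw [ex_const_mul]
            exact mul_le_mul_right (ih _ k π') _
        _ ≤ ENNReal.ofReal (Real.exp κ) * ENNReal.ofReal (Real.exp (k * κ)) := by
            rw [ex_mul_const]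
            exact mul_le_mul_left (h π) _
        _ = ENNReal.ofReal (Real.exp ((k + 1 : ℕ) * κ)) := by
            rw [← ENNReal.ofReal_mul (Real.exp_pos _).le, ← Real.exp_add]
            push_cast; ring_nf

theorem ex_evolve_dOrd_le (hn : 2 ≤ n) (α : ℕ) (z : Player n) (v : Fin n) (π : Prefs n) :
    ex (evolve α π) (fun π' => 2 ^ dOrd (π z) (π' z) v) ≤
      ENNReal.ofReal (Real.exp (α * (2 / n ^ 2))) :=
  ex_evolve_le (f := fun π π' => dOrd (π z) (π' z) v) (fun _ => dOrd_self _ _)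
    (fun _ _ _ => dOrd_triangle _ _ _ _) (fun π => ex_evolveOnce_dOrd_le hn z v π) α π

theorem ex_evolve_dMov_le (hn : 2 ≤ n) (α : ℕ) (z : Player n) (π : Prefs n) :
    ex (evolve α π) (fun π' => 2 ^ dMov (π z) (π' z)) ≤
      ENNReal.ofReal (Real.exp (α * (2 / n))) :=
  ex_evolve_le (f := fun π π' => dMov (π z) (π' z)) (fun _ => dMov_self _)
    (fun _ _ _ => dMov_triangle _ _ _) (fun π => ex_evolveOnce_dMov_le hn z π) α π

/-- In one time-step an element is unlikely to move. -/
theorem prob_evolve_dOrd_le (hn : 2 ≤ n) {α : ℕ} (hα : 2 * α ≤ n ^ 2) (z : Player n) (v : Fin n)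
    (π : Prefs n) : prob (evolve α π) (fun π' => dOrd (π z) (π' z) v ≠ 0) ≤
      ENNReal.ofReal (4 * α / n ^ 2) := by
  -- A natural number `d` satisfies 2 ^ d ≥ 1 + 1[d ≠ 0].
  have h1 : prob (evolve α π) (fun π' => dOrd (π z) (π' z) v ≠ 0) + 1 ≤
      ENNReal.ofReal (Real.exp (α * (2 / n ^ 2))) := by
    refine le_trans ?_ (ex_evolve_dOrd_le hn α z v π)
    rw [← ex_const (evolve α π) 1, prob, ← ex_add]
    refine ex_mono fun π' => ?_
    split_ifs with h
    · calc (1 : ℝ≥0∞) + 1 = 2 ^ 1 := by norm_num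
        _ ≤ _ := pow_le_pow_right₀ (by norm_num) (Nat.one_le_iff_ne_zero.2 h)
    · rw [not_not] at h
      simp [h]
  have hn' : (0 : ℝ) < n := by exact_mod_cast (by omega : 0 < n)
  have hα' : (2 : ℝ) * α ≤ n ^ 2 := by exact_mod_cast hα
  have hx : (α : ℝ) * (2 / n ^ 2) ≤ 1 := by
    rw [← mul_div_assoc, div_le_one (by positivity)]; linarith
  have hx0 : (0 : ℝ) ≤ α * (2 / n ^ 2) := by positivity
  -- This is exp x ≤ 1 + 2x for 0 ≤ x ≤ 1.
  have hexp : Real.exp (α * (2 / n ^ 2)) ≤ 4 * α / n ^ 2 + 1 := by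
    have := Real.abs_exp_sub_one_le (x := α * (2 / n ^ 2)) (by rwa [abs_of_nonneg hx0])
    rw [abs_of_nonneg hx0] at this
    have h2 := (le_abs_self _).trans this
    have h3 : 2 * ((α : ℝ) * (2 / n ^ 2)) = 4 * α / n ^ 2 := by ring
    linarith
  have h2 := h1.trans (ENNReal.ofReal_le_ofReal hexp)
  rw [ENNReal.ofReal_add (by positivity) (by norm_num), ENNReal.ofReal_one] at h2
  exact (ENNReal.add_le_add_iff_right ENNReal.one_ne_top).1 h2

/-! ### The duration of the sorting -/

theorem ex_run_bind_pow (α : ℕ) {X Y : Type} (a : QueryAlg n X) (g : X → QueryAlg n Y)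
    (π : Prefs n) (x : ℝ≥0∞) :
    ex (run α (a.bind g) π) (fun r => x ^ r.2.length) = ex (run α a π) fun r =>
      x ^ r.2.length * ex (run α (g r.1) (r.2.getLastD π)) fun q => x ^ q.2.length := by
  rw [run_bind, ex_bind]
  congr 1
  funext r
  rw [ex_map, ← ex_const_mul]
  simp only [List.length_append, pow_add]

theorem partition_trace_length {α : ℕ} {z : Player n} {p : Fin n} {l : List (Fin n)} {π : Prefs n}
    {r : {q : List (Fin n) × List (Fin n) // List.Perm (q.1 ++ q.2) l} × List (Prefs n)}
    (h : r ∈ (run α (partition z p l) π).support) : r.2.length = l.length := by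
  induction l generalizing π with
  | nil =>
    simp only [partition, run, PMF.mem_support_pure_iff] at h
    simp [h]
  | cons u l ih =>
    simp only [partition] at h
    obtain ⟨π', -, s, hs, rfl⟩ := mem_support_run_query.1 h
    rw [run_bind_ret, PMF.mem_support_map_iff] at hs
    obtain ⟨q, hq, rfl⟩ := hs
    simp [ih hq]

/-- The number of elements that are put before the pivot is nearly the rank of the pivot. -/
theorem ex_partition_le {α : ℕ} {δ : ℝ≥0∞} {z : Player n} {p : Fin n}
    (hδ : ∀ π, prob (evolve α π) (fun π' => dOrd (π z) (π' z) p ≠ 0) ≤ δ)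
    {G : ℕ → ℝ≥0∞} {c : ℝ≥0∞} {l : List (Fin n)} (hG : ∀ k ≤ l.length, G k ≤ c) (π : Prefs n) :
    ex (run α (partition z p l) π) (fun r => G r.1.1.1.length) ≤
      G (l.countP fun u => π z u < π z p) + l.length * δ * c := by
  induction l generalizing G π with
  | nil => simp [partition, run, ex_pure]
  | cons u l ih =>
    set b : ℕ := if π z u < π z p then 1 else 0 with hb
    have hb1 : b ≤ 1 := by rw [hb]; split_ifs <;> omega
    have step : ∀ π' : Prefs n,
        ex (run α ((partition z p l).bind fun q =>
          (QueryAlg.ret (match decide (π z u < π z p) with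
            | true => ⟨(u :: q.1.1, q.1.2), by simpa using q.2⟩
            | false => ⟨(q.1.1, u :: q.1.2), List.perm_middle.trans (q.2.cons u)⟩) :
            QueryAlg n {q : List (Fin n) × List (Fin n) // List.Perm (q.1 ++ q.2) (u :: l)})) π')
          (fun r => G r.1.1.1.length) =
        ex (run α (partition z p l) π') fun r => G (r.1.1.1.length + b) := by
      intro π'
      rw [run_bind_ret, ex_map]
      congr 1
      funext r
      by_cases hc : π z u < π z p
      · simp [hc, hb]
      · simp [hc, hb]
    have hcount : (u :: l).countP (fun u => π z u < π z p) =
        l.countP (fun u => π z u < π z p) + b := by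
      rw [List.countP_cons, hb]; simp
    have hlen : ∀ (P : Fin n → Bool), l.countP P + b ≤ (u :: l).length := fun P => by
      have := List.countP_le_length (p := P) (l := l)
      simp only [List.length_cons]; omega
    simp only [partition, run]
    rw [ex_bind]
    simp only [ex_map]
    -- If the pivot keeps its order in this step, the remaining comparisons aim at the same count as
    -- before, shifted by `b`. Otherwise, with probability at most `δ`, the worst-case bound `c` is
    -- paid.
    calc _ ≤ ex (evolve α π) (fun π' => (G ((u :: l).countP fun u => π z u < π z p) +
            l.length * δ * c) + (if dOrd (π z) (π' z) p ≠ 0 then 1 else 0) * c) := by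
          refine ex_mono fun π' => ?_
          refine (step π').le.trans ?_
          refine (ih (G := fun k => G (k + b)) (fun k hk => hG _ (by
            simp only [List.length_cons]; omega)) π').trans ?_
          rw [hcount]
          split_ifs with h
          · have := hG _ (hlen fun u => π' z u < π' z p)
            calc _ ≤ c + l.length * δ * c := add_le_add_left this _
              _ = l.length * δ * c + 1 * c := by ring
              _ ≤ _ := add_le_add_left le_add_self _
          · rw [not_not, dOrd_eq_zero] at h
            simp only [h]
            exact le_self_add
      _ ≤ (G ((u :: l).countP fun u => π z u < π z p) + l.length * δ * c) + δ * c := by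
          rw [ex_add, ex_const, ex_mul_const]
          refine add_le_add_right (mul_le_mul_left ?_ _) _
          refine le_trans (le_of_eq ?_) (hδ π)
          unfold prob
          congr 1
          funext π'
          congr 1
      _ = _ := by simp only [List.length_cons]; push_cast; ring

/-- The pivot does not precede itself, so erasing it leaves the count unchanged: the count is the
rank of the pivot in `l`. -/
theorem countP_eraseIdx (τ : Equiv.Perm (Fin n)) {l : List (Fin n)} (hl : l.Nodup)
    (i : Fin l.length) : (l.eraseIdx i).countP (fun u => τ u < τ l[i]) =
      (l.toFinset.filter fun u => τ u < τ l[i]).card := by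
  have h1 := (List.getElem_cons_eraseIdx_perm (l := l) i.isLt).countP_eq
    (fun u => decide (τ u < τ l[i]))
  rw [List.countP_cons] at h1
  simp only [Fin.getElem_fin, lt_self_iff_false, decide_false, Bool.false_eq_true, if_false,
    Nat.add_zero] at h1
  simp only [Fin.getElem_fin]
  rw [h1, List.countP_eq_length_filter, ← List.toFinset_card_of_nodup (hl.filter _),
    List.toFinset_filter]
  simp

/-- The rank of a uniformly random pivot is uniformly distributed. -/
theorem sum_countP_eraseIdx (τ : Equiv.Perm (Fin n)) {l : List (Fin n)} (hl : l.Nodup)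
    (G : ℕ → ℝ≥0∞) :
    ∑ i : Fin l.length, G ((l.eraseIdx i).countP fun u => τ u < τ l[i]) =
      ∑ k ∈ Finset.range l.length, G k := by
  classical
  simp_rw [countP_eraseIdx τ hl]
  set rk : Fin l.length → ℕ := fun i => (l.toFinset.filter fun u => τ u < τ l[i]).card with hrk
  -- Ranks increase strictly with `τ`, so they are distinct and, being below the length, exhaust the
  -- range.
  have hlt : ∀ i j : Fin l.length, τ l[i] < τ l[j] → rk i < rk j := by
    intro i j hij
    refine Finset.card_lt_card (Finset.ssubset_iff_of_subset ?_ |>.2 ⟨l[i], ?_, ?_⟩)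
    · intro u hu
      rw [Finset.mem_filter] at hu ⊢
      exact ⟨hu.1, hu.2.trans hij⟩
    · rw [Finset.mem_filter, List.mem_toFinset]
      exact ⟨List.getElem_mem _, hij⟩
    · simp
  have hinj : Function.Injective rk := by
    intro i j hij
    by_contra hne
    have : τ l[i] ≠ τ l[j] := fun h => hne (by
      have := τ.injective h
      exact Fin.ext ((hl.getElem_inj_iff).1 this))
    rcases lt_or_gt_of_ne this with h | h
    · exact absurd hij (hlt i j h).ne
    · exact absurd hij (hlt j i h).ne'
  have himg : Finset.univ.image rk = Finset.range l.length := by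
    refine Finset.eq_of_subset_of_card_le ?_ ?_
    · intro k hk
      rw [Finset.mem_image] at hk
      obtain ⟨i, -, rfl⟩ := hk
      rw [Finset.mem_range]
      calc rk i < l.toFinset.card := by
            refine Finset.card_lt_card (Finset.filter_ssubset.2 ⟨l[i], ?_, lt_irrefl _⟩)
            rw [List.mem_toFinset]; exact List.getElem_mem _
        _ = l.length := List.toFinset_card_of_nodup hl
    · rw [Finset.card_image_of_injective _ hinj]; simp
  rw [← himg, Finset.sum_image (fun i _ j _ h => hinj h)]

/-- Any `φ` satisfying the quicksort recursion dominates the exponential moment of the number of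
queries. With `m` elements besides the pivot, partitioning takes exactly `m` queries, which gives `x
^ m`; the average runs over the rank of the pivot; the term with `δ` pays for a pivot that moves,
when `hmul` bounds any split whatsoever. -/
theorem ex_quicksort_pow_le {α : ℕ} {δ x : ℝ≥0∞} {z : Player n}
    (hδ : ∀ p π, prob (evolve α π) (fun π' => dOrd (π z) (π' z) p ≠ 0) ≤ δ)
    {φ : ℕ → ℝ≥0∞} (h0 : 1 ≤ φ 0)
    (hmul : ∀ m < n, ∀ k ≤ m, φ k * φ (m - k) ≤ φ (m + 1))
    (hφ : ∀ m < n, x ^ m * (((m + 1 : ℕ) : ℝ≥0∞)⁻¹ *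
      (∑ k ∈ Finset.range (m + 1), φ k * φ (m - k)) + m * δ * φ (m + 1)) ≤ φ (m + 1))
    (m : ℕ) {l : List (Fin n)} (hm : l.length ≤ m) (hl : l.Nodup) (π : Prefs n) :
    ex (run α (quicksort z l) π) (fun r => x ^ r.2.length) ≤ φ l.length := by
  induction m generalizing l π with
  | zero =>
    have : l = [] := List.length_eq_zero_iff.1 (by omega)
    subst this
    simpa [quicksort, run, ex_pure] using h0
  | succ m ih =>
    cases l with
    | nil => simpa [quicksort, run, ex_pure] using h0
    | cons a as =>
      have hn : as.length < n := by
        have := hl.length_le_card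
        simpa [Fintype.card_fin] using this
      rw [quicksort, run, ex_bind, ex_uniform, Fintype.card_fin]
      have hpiv : ∀ i : Fin (as.length + 1),
          ex (run α ((partition z (a :: as)[i] ((a :: as).eraseIdx i)).bind fun q =>
            (quicksort z q.1.1).bind fun lo => (quicksort z q.1.2).bind fun hi =>
            (QueryAlg.ret ⟨lo.1 ++ (a :: as)[i] :: hi.1,
              List.perm_middle.trans ((((lo.2.append hi.2).trans q.2).cons _).trans
                (List.getElem_cons_eraseIdx_perm i.isLt))⟩ :
              QueryAlg n {l' : List (Fin n) // List.Perm l' (a :: as)})) π)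
            (fun r => x ^ r.2.length) ≤
          x ^ as.length * (φ (((a :: as).eraseIdx i).countP fun u => π z u < π z (a :: as)[i]) *
            φ (as.length - ((a :: as).eraseIdx i).countP fun u => π z u < π z (a :: as)[i]) +
            as.length * δ * φ (as.length + 1)) := by
        intro i
        have hel : ((a :: as).eraseIdx i).length = as.length := by
          rw [List.length_eraseIdx_of_lt i.isLt]; simp
        rw [ex_run_bind_pow]
        calc _ ≤ ex (run α (partition z (a :: as)[i] ((a :: as).eraseIdx i)) π) (fun r =>
              x ^ as.length * (φ r.1.1.1.length * φ (as.length - r.1.1.1.length))) := by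
              refine ex_mono_support fun r hr => ?_
              rw [partition_trace_length hr, hel]
              refine mul_le_mul_right ?_ _
              have hlen := r.1.2.length_eq
              rw [List.length_append, hel] at hlen
              have hnd : (r.1.1.1 ++ r.1.1.2).Nodup :=
                r.1.2.nodup_iff.2 (hl.sublist (List.eraseIdx_sublist _ _))
              simp only [List.length_cons] at hm
              rw [ex_run_bind_pow]
              have hhi : as.length - r.1.1.1.length = r.1.1.2.length := by omega
              rw [hhi]
              calc _ ≤ ex (run α (quicksort z r.1.1.1) (r.2.getLastD π)) (fun r' =>
                    x ^ r'.2.length * φ r.1.1.2.length) := by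
                    refine ex_mono fun r' => mul_le_mul_right ?_ _
                    rw [run_bind_ret, ex_map]
                    exact ih (by omega) hnd.of_append_right _
                _ ≤ _ := by
                    rw [ex_mul_const]
                    exact mul_le_mul_left (ih (by omega) hnd.of_append_left _) _
          _ ≤ _ := by
              rw [ex_const_mul]
              refine mul_le_mul_right ?_ _
              have := ex_partition_le (α := α) (δ := δ) (z := z) (p := (a :: as)[i]) (hδ _)
                (G := fun k => φ k * φ (as.length - k)) (c := φ (as.length + 1))
                (l := (a :: as).eraseIdx i) (by
                  intro k hk; exact hmul _ hn k (by omega)) π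
              rwa [hel] at this
      refine le_trans (mul_le_mul_right (Finset.sum_le_sum fun i _ => hpiv i) _) ?_
      refine le_trans (le_of_eq ?_) (hφ as.length hn)
      have hsum := sum_countP_eraseIdx (π z) hl fun k => φ k * φ (as.length - k)
      simp only [List.length_cons] at hsum
      rw [← hsum, ← Finset.mul_sum, Finset.sum_add_distrib]
      simp only [Finset.sum_const, Finset.card_univ, Fintype.card_fin, nsmul_eq_mul]
      rw [mul_left_comm, mul_add]
      congr 2
      rw [← mul_assoc, ENNReal.inv_mul_cancel (by simp) (ENNReal.natCast_ne_top _), one_mul]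

/-! ### The recursion for the exponential moments of the duration -/

theorem mul_log_le {k M : ℕ} (h : k ≤ M) : (k : ℝ) * Real.log k ≤ k * Real.log M := by
  rcases Nat.eq_zero_or_pos k with rfl | hk
  · simp
  · have : Real.log k ≤ Real.log M := Real.log_le_log (by exact_mod_cast hk) (by exact_mod_cast h)
    gcongr

theorem mul_log_le_of_four_mul_le {k M : ℕ} (h : 4 * k ≤ 3 * M) :
    (k : ℝ) * Real.log k ≤ k * (Real.log M - 1 / 4) := by
  rcases Nat.eq_zero_or_pos k with rfl | hk
  · simp
  · have hk' : (0 : ℝ) < k := by exact_mod_cast hk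
    have hM' : (0 : ℝ) < M := by exact_mod_cast (by omega : 0 < M)
    have h' : (4 : ℝ) * k ≤ 3 * M := by exact_mod_cast h
    have h1 : Real.log (k / M) ≤ k / M - 1 := Real.log_le_sub_one_of_pos (by positivity)
    rw [Real.log_div hk'.ne' hM'.ne'] at h1
    have h2 : (k : ℝ) / M ≤ 3 / 4 := by rw [div_le_iff₀ hM']; linarith
    have : Real.log k ≤ Real.log M - 1 / 4 := by linarith
    gcongr

theorem mul_log_add_mul_log_le {k m : ℕ} (h : k ≤ m) :
    (k : ℝ) * Real.log k + (m - k : ℕ) * Real.log (m - k : ℕ) ≤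
      (m + 1 : ℕ) * Real.log (m + 1 : ℕ) := by
  have h1 := mul_log_le (k := k) (M := m + 1) (by omega)
  have h2 := mul_log_le (k := m - k) (M := m + 1) (by omega)
  have h3 : (0 : ℝ) ≤ Real.log (m + 1 : ℕ) := Real.log_natCast_nonneg _
  have h4 : ((m - k : ℕ) : ℝ) = m - k := by rw [Nat.cast_sub h]
  have h5 : ((m + 1 : ℕ) : ℝ) = m + 1 := by push_cast; ring
  rw [h4] at h2 ⊢
  nlinarith

/-- Both parts have at most 3/4 of m + 1 elements, so each logarithm drops by at least 1/4. The two
sizes add up to `m` only, one short of m + 1; this is harmless since log (m + 1) ≥ log 2 ≥ 1/4. -/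
theorem mul_log_add_mul_log_le_sub {k m : ℕ} (h : k ≤ m) (hm : 1 ≤ m) (h1 : 4 * k ≤ 3 * (m + 1))
    (h2 : 4 * (m - k) ≤ 3 * (m + 1)) :
    (k : ℝ) * Real.log k + (m - k : ℕ) * Real.log (m - k : ℕ) ≤
      (m + 1 : ℕ) * Real.log (m + 1 : ℕ) - (m + 1 : ℕ) / 4 := by
  have h1 := mul_log_le_of_four_mul_le h1
  have h2 := mul_log_le_of_four_mul_le h2
  have h3 : Real.log 2 ≤ Real.log (m + 1 : ℕ) :=
    Real.log_le_log (by norm_num) (by exact_mod_cast (by omega : 2 ≤ m + 1))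
  have h4 : ((m - k : ℕ) : ℝ) = m - k := by rw [Nat.cast_sub h]
  have h5 : ((m + 1 : ℕ) : ℝ) = m + 1 := by push_cast; ring
  have := Real.log_two_gt_d9
  rw [h4] at h2 ⊢
  generalize Real.log (m + 1 : ℕ) = L at *
  rw [h5]
  nlinarith

/-- At most half of the ranks of a pivot lead to unbalanced partitions. -/
theorem card_unbalanced_le (m : ℕ) :
    2 * ((Finset.range (m + 1)).filter fun k =>
      ¬(4 * k ≤ 3 * (m + 1) ∧ 4 * (m - k) ≤ 3 * (m + 1))).card ≤ m + 1 := by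
  have hsub : ((Finset.range (m + 1)).filter fun k =>
      ¬(4 * k ≤ 3 * (m + 1) ∧ 4 * (m - k) ≤ 3 * (m + 1))) ⊆
      Finset.Ico (3 * (m + 1) / 4 + 1) (m + 1) ∪ Finset.range ((m + 1) / 4) := by
    intro k hk
    simp only [Finset.mem_filter, Finset.mem_range, Finset.mem_union, Finset.mem_Ico] at hk ⊢
    omega
  have := (Finset.card_le_card hsub).trans (Finset.card_union_le _ _)
  rw [Nat.card_Ico, Finset.card_range] at this
  omega

/-- `exp (16 k log k / (10 n))`, a bound for the exponential moment of the duration of the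
sorting of `k` elements. -/
noncomputable def sortMoment (n k : ℕ) : ℝ :=
  Real.exp (16 / (10 * n) * (k * Real.log k))

theorem sortMoment_mul_le {k m : ℕ} (h : k ≤ m) :
    sortMoment n k * sortMoment n (m - k) ≤ sortMoment n (m + 1) := by
  rw [sortMoment, sortMoment, sortMoment, ← Real.exp_add, ← mul_add]
  exact Real.exp_le_exp.2 (mul_le_mul_of_nonneg_left (mul_log_add_mul_log_le h) (by positivity))

/-- One level of the recursion: `exp θ` is the cost of partitioning, half of the splits save a
factor `exp (-4θ)`, and `θ / 10` is the correction for moving pivots. The constant 2.2 below makes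
the bracket at most 1 - 1.1 θ + 0.1 θ = 1 - θ. -/
theorem exp_mul_half_le_one {θ : ℝ} (h0 : 0 ≤ θ) (h1 : θ ≤ 1 / 10) :
    Real.exp θ * ((1 + Real.exp (-(4 * θ))) / 2 + θ / 10) ≤ 1 := by
  have e1 : Real.exp (-(4 * θ)) ≤ (1 + 4 * θ)⁻¹ := by
    rw [Real.exp_neg]
    exact inv_anti₀ (by linarith) (by linarith [Real.add_one_le_exp (4 * θ)])
  have e2 : Real.exp θ * (1 - θ) ≤ 1 := by
    have h := Real.add_one_le_exp (-θ)
    calc Real.exp θ * (1 - θ) ≤ Real.exp θ * Real.exp (-θ) := by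
          gcongr; linarith
      _ = 1 := by rw [← Real.exp_add]; simp
  have e3 : (1 + 4 * θ)⁻¹ ≤ 1 - 2.2 * θ := by
    rw [inv_le_iff_one_le_mul₀ (by linarith)]
    nlinarith
  calc _ ≤ Real.exp θ * (1 - θ) := by gcongr; linarith
    _ ≤ 1 := e2

theorem sortMoment_recursion {α m : ℕ} (hn : 400 * α ≤ n) (hm : m < n) :
    Real.exp (1 / (10 * n)) ^ m * (((m + 1 : ℕ) : ℝ)⁻¹ *
      (∑ k ∈ Finset.range (m + 1), sortMoment n k * sortMoment n (m - k)) +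
        m * (4 * α / n ^ 2) * sortMoment n (m + 1)) ≤ sortMoment n (m + 1) := by
  have hn0 : (0 : ℝ) < n := by exact_mod_cast (by omega : 0 < n)
  rcases Nat.eq_zero_or_pos m with rfl | hm0
  · simp [sortMoment]
  -- With this `θ`, the saving (m + 1)/4 of a balanced split, multiplied by 16/(10n), is exactly 4θ.
  set θ : ℝ := (m + 1 : ℕ) / (10 * n) with hθ
  have hθ0 : 0 ≤ θ := by positivity
  have hmn : ((m + 1 : ℕ) : ℝ) ≤ n := by exact_mod_cast hm
  have hθ1 : θ ≤ 1 / 10 := by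
    rw [hθ, div_le_div_iff₀ (by positivity) (by norm_num)]; linarith
  set Φ := sortMoment n (m + 1) with hΦ
  have hΦ0 : 0 ≤ Φ := (Real.exp_pos _).le
  set y := Real.exp (-(4 * θ)) with hy
  have hy0 : 0 ≤ y := (Real.exp_pos _).le
  have hy1 : y ≤ 1 := Real.exp_le_one_iff.2 (by linarith)
  have hterm : ∀ k ∈ Finset.range (m + 1), sortMoment n k * sortMoment n (m - k) ≤
      Φ * y + if ¬(4 * k ≤ 3 * (m + 1) ∧ 4 * (m - k) ≤ 3 * (m + 1)) then Φ * (1 - y) else 0 := by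
    intro k hk
    rw [Finset.mem_range] at hk
    split_ifs with hbad
    · rw [add_zero, hΦ, hy, sortMoment, sortMoment, sortMoment, ← Real.exp_add, ← Real.exp_add,
        ← mul_add]
      refine Real.exp_le_exp.2 ?_
      have := mul_le_mul_of_nonneg_left
        (mul_log_add_mul_log_le_sub (k := k) (by omega) hm0 hbad.1 hbad.2)
        (show (0 : ℝ) ≤ 16 / (10 * n) by positivity)
      refine this.trans_eq ?_
      rw [hθ]; ring
    · have := sortMoment_mul_le (n := n) (k := k) (m := m) (by omega)
      linarith
  have hsum : ∑ k ∈ Finset.range (m + 1), sortMoment n k * sortMoment n (m - k) ≤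
      (m + 1 : ℕ) * (Φ * ((1 + y) / 2)) := by
    refine (Finset.sum_le_sum hterm).trans ?_
    rw [Finset.sum_add_distrib, ← Finset.sum_filter]
    simp only [Finset.sum_const, Finset.card_range, nsmul_eq_mul]
    have hc : (2 : ℝ) * ((Finset.range (m + 1)).filter fun k =>
      ¬(4 * k ≤ 3 * (m + 1) ∧ 4 * (m - k) ≤ 3 * (m + 1))).card ≤ (m + 1 : ℕ) := by
      exact_mod_cast card_unbalanced_le m
    have h0 : 0 ≤ Φ * (1 - y) := mul_nonneg hΦ0 (by linarith)
    nlinarith [mul_le_mul_of_nonneg_right hc h0]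
  have hexp : Real.exp (1 / (10 * n)) ^ m ≤ Real.exp θ := by
    rw [← Real.exp_nat_mul]
    refine Real.exp_le_exp.2 ?_
    rw [hθ, mul_one_div]
    gcongr
    omega
  -- This is where `400 * α ≤ n` enters: 4α/n² ≤ 1/(100n).
  have hδ : (m : ℝ) * (4 * α / n ^ 2) ≤ θ / 10 := by
    have hα : (400 : ℝ) * α ≤ n := by exact_mod_cast hn
    have hm1 : (m : ℝ) ≤ (m + 1 : ℕ) := by exact_mod_cast Nat.le_succ m
    rw [hθ, ← mul_div_assoc, div_div, div_le_div_iff₀ (by positivity) (by positivity)]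
    calc (m : ℝ) * (4 * α) * (10 * n * 10) = m * (400 * α) * n := by ring
      _ ≤ (m + 1 : ℕ) * n * n := by gcongr
      _ = _ := by ring
  have hpos : (0 : ℝ) < (m + 1 : ℕ) := by positivity
  calc _ ≤ Real.exp θ * (((m + 1 : ℕ) : ℝ)⁻¹ * ((m + 1 : ℕ) * (Φ * ((1 + y) / 2))) +
        θ / 10 * Φ) := by
        have h0 : 0 ≤ ∑ k ∈ Finset.range (m + 1), sortMoment n k * sortMoment n (m - k) :=
          Finset.sum_nonneg fun k _ => (mul_pos (Real.exp_pos _) (Real.exp_pos _)).le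
        gcongr
    _ = Real.exp θ * ((1 + y) / 2 + θ / 10) * Φ := by
        rw [inv_mul_cancel_left₀ hpos.ne']; ring
    _ ≤ 1 * Φ := by
        gcongr
        exact exp_mul_half_le_one hθ0 hθ1
    _ = Φ := one_mul _

/-- The weight of a time-step in the exponential moments of durations. -/
noncomputable def stepWeight (n : ℕ) : ℝ≥0∞ := ENNReal.ofReal (Real.exp (1 / (10 * n)))

theorem stepWeight_pow (j : ℕ) :
    stepWeight n ^ j = ENNReal.ofReal (Real.exp (j / (10 * n))) := by
  rw [stepWeight, ← ENNReal.ofReal_pow (Real.exp_pos _).le, ← Real.exp_nat_mul, mul_one_div]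

theorem ex_quicksort_le {α : ℕ} (hn : 2 ≤ n) (hα : 400 * α ≤ n) (z : Player n) (π : Prefs n) :
    ex (run α (quicksort z (List.finRange n)) π) (fun r => stepWeight n ^ r.2.length) ≤
      ENNReal.ofReal (Real.exp (8 / 5 * Real.log n)) := by
  have hs : ∀ k, 0 ≤ sortMoment n k := fun k => (Real.exp_pos _).le
  have h := ex_quicksort_pow_le (α := α) (δ := ENNReal.ofReal (4 * α / n ^ 2))
    (x := stepWeight n) (z := z)
    (fun p π => prob_evolve_dOrd_le hn (by nlinarith) z p π)
    (φ := fun k => ENNReal.ofReal (sortMoment n k)) (by simp [sortMoment])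
    (fun m _ k hk => by
      rw [← ENNReal.ofReal_mul (hs _)]
      exact ENNReal.ofReal_le_ofReal (sortMoment_mul_le hk))
    (fun m hm => by
      refine le_trans (le_of_eq ?_) (ENNReal.ofReal_le_ofReal (sortMoment_recursion hα hm))
      have h1 : 0 ≤ ∑ k ∈ Finset.range (m + 1), sortMoment n k * sortMoment n (m - k) :=
        Finset.sum_nonneg fun k _ => mul_nonneg (hs _) (hs _)
      have h2 : (0 : ℝ) ≤ m * (4 * α / n ^ 2) := by positivity
      rw [ENNReal.ofReal_mul (by positivity), ENNReal.ofReal_pow (Real.exp_pos _).le,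
        ENNReal.ofReal_add (mul_nonneg (by positivity) h1) (mul_nonneg h2 (hs _)),
        ENNReal.ofReal_mul (by positivity), ENNReal.ofReal_mul h2,
        ENNReal.ofReal_mul (by positivity),
        ENNReal.ofReal_sum_of_nonneg (fun k _ => mul_nonneg (hs _) (hs _)),
        ENNReal.ofReal_inv_of_pos (by positivity)]
      simp only [ENNReal.ofReal_natCast, ENNReal.ofReal_mul (hs _), stepWeight])
    n (l := List.finRange n) (by simp) (List.nodup_finRange n) π
  refine h.trans (le_of_eq ?_)
  simp only [List.length_finRange, sortMoment]
  congr 2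
  have hn0 : (n : ℝ) ≠ 0 := by exact_mod_cast (by omega : n ≠ 0)
  field_simp
  ring

/-! ### The duration of a round -/

theorem ex_run_bind_pow_le {α : ℕ} {X Y : Type} {a : QueryAlg n X} {g : X → QueryAlg n Y}
    {x c d : ℝ≥0∞} (ha : ∀ π, ex (run α a π) (fun r => x ^ r.2.length) ≤ c)
    (hg : ∀ y π, ex (run α (g y) π) (fun r => x ^ r.2.length) ≤ d) (π : Prefs n) :
    ex (run α (a.bind g) π) (fun r => x ^ r.2.length) ≤ c * d := by
  rw [ex_run_bind_pow]
  calc _ ≤ ex (run α a π) (fun r => x ^ r.2.length * d) :=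
        ex_mono fun r => mul_le_mul_right (hg _ _) _
    _ ≤ _ := by
        rw [ex_mul_const]
        exact mul_le_mul_left (ha π) _

theorem ex_sequentialSort_le {α : ℕ} (hn : 2 ≤ n) (hα : 400 * α ≤ n) (zs : List (Player n))
    (acc π : Prefs n) :
    ex (run α (sequentialSort zs acc) π) (fun r => stepWeight n ^ r.2.length) ≤
      ENNReal.ofReal (Real.exp (8 / 5 * Real.log n)) ^ zs.length := by
  induction zs generalizing acc π with
  | nil => simp [sequentialSort, run, ex_pure]
  | cons z zs ih =>
    rw [sequentialSort, List.length_cons, pow_succ']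
    exact ex_run_bind_pow_le (ex_quicksort_le hn hα z) (fun _ => ih _) π

theorem length_allPlayers : (allPlayers n).length = 2 * n := by
  simp [allPlayers]; ring

theorem nodup_allPlayers : (allPlayers n).Nodup := by
  refine List.Nodup.append ((List.nodup_finRange n).map Sum.inl_injective)
    ((List.nodup_finRange n).map Sum.inr_injective) ?_
  intro z h1 h2
  simp only [List.mem_map] at h1 h2
  obtain ⟨x, -, rfl⟩ := h1
  obtain ⟨y, -, h⟩ := h2
  cases h

theorem mem_allPlayers (z : Player n) : z ∈ allPlayers n := by
  cases z <;> simp [allPlayers]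

theorem ex_matchRound_le {α : ℕ} (hn : 2 ≤ n) (hα : 400 * α ≤ n) (π : Prefs n) :
    ex (run α (matchRound n) π) (fun r => stepWeight n ^ r.2.length) ≤
      ENNReal.ofReal (Real.exp (16 / 5 * (n * Real.log n))) := by
  have h := ex_sequentialSort_le hn hα (allPlayers n) (fun _ => 1) π
  rw [length_allPlayers, ← ENNReal.ofReal_pow (Real.exp_pos _).le, ← Real.exp_nat_mul] at h
  rw [matchRound, run_bind_ret, ex_map]
  refine h.trans (le_of_eq ?_)
  push_cast
  ring_nf

/-! ### Tail bounds from the exponential moments. -/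

theorem prob_lt_length_le {α : ℕ} {X : Type} {a : QueryAlg n X} {π : Prefs n} {κ : ℝ}
    (h : ex (run α a π) (fun r => stepWeight n ^ r.2.length) ≤ ENNReal.ofReal (Real.exp κ))
    (j : ℕ) : prob (run α a π) (fun r => j < r.2.length) ≤
      ENNReal.ofReal (Real.exp (κ - j / (10 * n))) := by
  refine (prob_le_of_mul_le (f := fun r => stepWeight n ^ r.2.length)
    (c := ENNReal.ofReal (Real.exp (-(j / (10 * n))))) ?_).trans ?_
  · intro r hr
    rw [stepWeight_pow, ← ENNReal.ofReal_mul (Real.exp_pos _).le, ← Real.exp_add,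
      ENNReal.one_le_ofReal]
    refine Real.one_le_exp ?_
    have : (j : ℝ) / (10 * n) ≤ r.2.length / (10 * n) := by gcongr
    linarith
  · refine (mul_le_mul_right h _).trans (le_of_eq ?_)
    rw [← ENNReal.ofReal_mul (Real.exp_pos _).le, ← Real.exp_add]
    ring_nf

theorem prob_lt_pathSum_le {α : ℕ} {f : Prefs n → Prefs n → ℕ} {κ : ℝ} (hκ : 0 ≤ κ)
    (h : ∀ π, ex (evolve α π) (fun π' => 2 ^ f π π') ≤ ENNReal.ofReal (Real.exp κ))
    {X : Type} (a : QueryAlg n X) (k m : ℕ) (π : Prefs n) :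
    prob (run α a π) (fun r => m < pathSum f π (r.2.take k)) ≤
      ENNReal.ofReal (Real.exp (k * κ - m / 2)) := by
  refine (prob_le_of_mul_le (f := fun r => 2 ^ pathSum f π (r.2.take k))
    (c := ENNReal.ofReal (Real.exp (-(m / 2)))) ?_).trans ?_
  · intro r hr
    rw [show (2 : ℝ≥0∞) = ENNReal.ofReal (Real.exp (Real.log 2)) by
        rw [Real.exp_log (by norm_num)]; simp,
      ← ENNReal.ofReal_pow (Real.exp_pos _).le, ← Real.exp_nat_mul,
      ← ENNReal.ofReal_mul (Real.exp_pos _).le, ← Real.exp_add, ENNReal.one_le_ofReal]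
    refine Real.one_le_exp ?_
    have h1 : (m : ℝ) ≤ pathSum f π (r.2.take k) := by exact_mod_cast hr.le
    have h2 := Real.log_two_gt_d9
    have h3 : (0 : ℝ) ≤ m := by positivity
    -- The rate 1/2 in the tail is a convenient lower bound for log 2.
    nlinarith
  · refine (mul_le_mul_right (ex_run_take_le hκ h a k π) _).trans (le_of_eq ?_)
    rw [← ENNReal.ofReal_mul (Real.exp_pos _).le, ← Real.exp_add]
    ring_nf

/-- During the sorting of a list, few elements of this list move. -/
theorem prob_quicksort_dMov_le {α : ℕ} (hn : 2 ≤ n) (hα : 400 * α ≤ n) (z : Player n)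
    (π : Prefs n) (m L : ℕ) :
    prob (run α (quicksort z (List.finRange n)) π)
      (fun r => m < pathSum (fun π π' => dMov (π z) (π' z)) π r.2) ≤
      ENNReal.ofReal (Real.exp (8 / 5 * Real.log n - L / (10 * n))) +
        ENNReal.ofReal (Real.exp (L * (α * (2 / n)) - m / 2)) := by
  refine le_trans ?_ (add_le_add (prob_lt_length_le (ex_quicksort_le hn hα z π) L)
    (prob_lt_pathSum_le (by positivity) (ex_evolve_dMov_le hn α z)
      (quicksort z (List.finRange n)) L m π))
  refine le_trans (prob_mono fun r hr => ?_) (prob_or_le _ _ _)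
  by_cases hL : L < r.2.length
  · exact Or.inl hL
  · right
    rwa [List.take_of_length_le (not_lt.1 hL)]

/-- The result of a round differs little from the lists at the end of the round. -/
def AccurateRound (m : ℕ) (π : Prefs n) (r : Matching n × List (Prefs n)) : Prop :=
  ∃ σ, r.1 = galeShapley σ ∧ ∀ z v, dOrd (σ z) (r.2.getLastD π z) v ≤
    m + pathSum (fun π π' => dOrd (π z) (π' z) v) π r.2

theorem prob_not_accurateRound_le {α m : ℕ} {δ : ℝ≥0∞}
    (hδ : ∀ (z : Player n) (π : Prefs n), prob (run α (quicksort z (List.finRange n)) π)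
      (fun r => m < pathSum (fun π π' => dMov (π z) (π' z)) π r.2) ≤ δ) (π : Prefs n) :
    prob (run α (matchRound n) π) (fun r => ¬ AccurateRound m π r) ≤ (2 * n : ℕ) * δ := by
  have h := prob_sequentialSort_le hδ nodup_allPlayers (fun _ => 1) π
  rw [length_allPlayers] at h
  rw [matchRound, run_bind_ret, prob_map]
  refine le_trans (prob_mono fun r hr => ?_) h
  by_contra hcon
  push Not at hcon
  exact hr ⟨r.1, rfl, fun z v => hcon z (mem_allPlayers z) v⟩

/-! ### Renewal inequality -/

theorem NoRet.length_pos {α : ℕ} {X : Type} {a : QueryAlg n X} (h : NoRet a) {π : Prefs n}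
    {r : X × List (Prefs n)} (hr : r ∈ (run α a π).support) : 0 < r.2.length := by
  induction a with
  | ret x => exact absurd rfl (h (.ret x) (by simp [QueryAlg.settle]) x)
  | query z u v k ih =>
    obtain ⟨π', -, s, -, rfl⟩ := mem_support_run_query.1 hr
    simp
  | rand m k ih =>
    simp only [run, PMF.mem_support_bind_iff] at hr
    obtain ⟨i, hi, hr⟩ := hr
    exact ih i (fun c hc => h c (by
      simp only [QueryAlg.settle, PMF.mem_support_bind_iff]; exact ⟨i, hi, hc⟩)) hr

/-- The round started from the lists `π` is in progress after `k` time-steps, and `M` is then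
bad. -/
def BadAt (Bad : Prefs n → Matching n → Prop) (k : ℕ) (π : Prefs n) (M : Matching n)
    (r : Matching n × List (Prefs n)) : Prop :=
  k < r.2.length ∧ Bad ((r.2.take k).getLastD π) M

open Classical in
/-- The probability that after `j` time-steps the second round is in progress and the result of
the first one is bad. -/
noncomputable def secondRoundBad (α : ℕ) (Bad : Prefs n → Matching n → Prop) (j : ℕ)
    (π : Prefs n) : ℝ≥0∞ :=
  ex (run α (matchRound n) π) fun r =>
    if r.2.length ≤ j then
      prob (run α (matchRound n) (r.2.getLastD π))
        (BadAt Bad (j - r.2.length) (r.2.getLastD π) r.1)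
    else 0

/-- If the first round is over, its result is the output during the second round, and the same
argument applies with the second round as the first. The round that starts when `j` steps remain
thus contributes at most `Γ j`. Distinct rounds start with distinct `j`, so summing over all `j ≤ k`
suffices. -/
theorem prob_observe_le (hn : 2 ≤ n) {α : ℕ} {Bad : Prefs n → Matching n → Prop} {Γ : ℕ → ℝ≥0∞}
    (hΓ : ∀ j π, secondRoundBad α Bad j π ≤ Γ j) (k : ℕ) (π : Prefs n) (M : Matching n) :
    prob (observe α k ⟨π, M, matchRound n⟩) (fun s => Bad s.1 s.2) ≤
      prob (run α (matchRound n) π) (BadAt Bad k π M) + ∑ j ∈ Finset.range (k + 1), Γ j := by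
  classical
  induction k using Nat.strong_induction_on generalizing π M with
  | _ k ih =>
  rw [observe_matchRound α k π M (noRet_matchRound hn), prob_bind]
  calc _ ≤ ex (run α (matchRound n) π) (fun r => (if BadAt Bad k π M r then 1 else 0) +
        ((if r.2.length ≤ k then
          prob (run α (matchRound n) (r.2.getLastD π))
            (BadAt Bad (k - r.2.length) (r.2.getLastD π) r.1)
        else 0) + ∑ j ∈ Finset.range k, Γ j)) := by
        refine ex_mono_support fun r hr => ?_
        have hpos := (noRet_matchRound hn).length_pos hr
        unfold afterRound
        split_ifs with h1 h2 h2
        · exact absurd h2.1 (by omega)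
        · rw [zero_add]
          refine (ih (k - r.2.length) (by omega) _ _).trans ?_
          -- The first round took at least one step, so the induction hypothesis only involves
          -- indices below `k`, and `Γ k` remains for the present pair of rounds.
          gcongr
          omega
        · exact le_trans (prob_le_one _ _) le_self_add
        · rw [prob, ex_pure, if_neg]
          · exact zero_le
          · exact fun hb => h2 ⟨not_le.1 h1, hb⟩
    _ ≤ _ := by
        rw [ex_add, ex_add, ex_const, Finset.sum_range_succ, add_comm (Finset.sum _ _)]
        refine add_le_add (le_of_eq ?_) (add_le_add_left (le_trans (le_of_eq ?_) (hΓ k π)) _)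
        · unfold prob; congr 1
        · unfold secondRoundBad; congr 1

theorem secondRoundBad_le_prob_length (α : ℕ) (Bad : Prefs n → Matching n → Prop) (j : ℕ)
    (π : Prefs n) : secondRoundBad α Bad j π ≤
      prob (run α ((matchRound n).bind fun _ => matchRound n) π) fun r => j < r.2.length := by
  rw [run_bind, prob_bind]
  refine ex_mono fun r => ?_
  rw [prob_map]
  split_ifs with h
  · refine prob_mono fun q hq => ?_
    have := hq.1
    simp only [List.length_append]
    omega
  · exact zero_le

/-- The discrepancy is at most `m` from the sort, plus the drift during the rest of the first round
and the elapsed part of the second. Both drifts are covered by one path sum over the first `j` steps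
of two rounds, which is at most `m` outside the second event. So `dOrd ≤ 2 * m`, whence `4 * n * m`.
-/
theorem secondRoundBad_le {α m : ℕ} (j : ℕ) (π : Prefs n) :
    secondRoundBad α (fun π M => 4 * n * m < numBlocking π M) j π ≤
      prob (run α (matchRound n) π) (fun r => ¬ AccurateRound m π r) +
      prob (run α ((matchRound n).bind fun _ => matchRound n) π) fun r =>
        ∃ e : Player n × Fin n,
          m < pathSum (fun π π' => dOrd (π e.1) (π' e.1) e.2) π (r.2.take j) := by
  rw [run_bind, prob_bind, prob, ← ex_add]
  refine ex_mono fun r => ?_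
  by_cases hacc : AccurateRound m π r
  swap
  · rw [if_pos hacc]
    refine le_trans ?_ le_self_add
    split_ifs
    · exact prob_le_one _ _
    · exact zero_le
  · rw [if_neg (not_not.2 hacc), zero_add, prob_map]
    split_ifs with hj
    swap
    · exact zero_le
    refine prob_mono fun q hq => ?_
    by_contra hcon
    push Not at hcon
    obtain ⟨σ, hM, hσ⟩ := hacc
    refine absurd hq.2 (not_lt.2 ?_)
    rw [hM]
    refine (numBlocking_galeShapley_le σ _ (b := 2 * m) fun z v => ?_).trans_eq (by ring)
    have h1 := hσ z v
    have h2 := hcon (z, v)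
    dsimp only at h2
    rw [List.take_append, List.take_of_length_le hj, pathSum_append] at h2
    have h3 := dOrd_getLastD_le z v (r.2.getLastD π) (q.2.take (j - r.2.length))
    have h4 := dOrd_triangle (σ z) (r.2.getLastD π z)
      ((q.2.take (j - r.2.length)).getLastD (r.2.getLastD π) z) v
    omega

/-! ### The main bound -/

/-- After few steps, the result of a round is bad only with small probability. -/
theorem secondRoundBad_le_ofReal {α : ℕ} (hn : 2 ≤ n) (hα : 400 * α ≤ n) (m L j : ℕ)
    (π : Prefs n) :
    secondRoundBad α (fun π M => 4 * n * m < numBlocking π M) j π ≤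
      ENNReal.ofReal (2 * n * (Real.exp (8 / 5 * Real.log n - L / (10 * n)) +
        Real.exp (L * (α * (2 / n)) - m / 2)) +
        2 * n * n * Real.exp (j * (α * (2 / n ^ 2)) - m / 2)) := by
  refine (secondRoundBad_le j π).trans ?_
  rw [ENNReal.ofReal_add (by positivity) (by positivity)]
  refine add_le_add ?_ ?_
  · refine (prob_not_accurateRound_le
      (fun z π => prob_quicksort_dMov_le hn hα z π m L) π).trans (le_of_eq ?_)
    rw [ENNReal.ofReal_mul (by positivity), ENNReal.ofReal_add (Real.exp_pos _).le
      (Real.exp_pos _).le, ← ENNReal.ofReal_natCast]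
    push_cast; rfl
  · refine (prob_exists_le _ _).trans ?_
    refine (Finset.sum_le_sum fun e _ => prob_lt_pathSum_le (by positivity)
      (ex_evolve_dOrd_le hn α e.1 e.2) ((matchRound n).bind fun _ => matchRound n) j m π).trans ?_
    rw [Finset.sum_const, Finset.card_univ, nsmul_eq_mul, ENNReal.ofReal_mul (by positivity),
      ← ENNReal.ofReal_natCast]
    refine le_of_eq ?_
    congr 2
    simp only [Fintype.card_prod, Fintype.card_sum, Fintype.card_fin]
    push_cast; ring

theorem secondRoundBad_le_tail {α : ℕ} (hn : 2 ≤ n) (hα : 400 * α ≤ n)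
    (Bad : Prefs n → Matching n → Prop) (j : ℕ) (π : Prefs n) :
    secondRoundBad α Bad j π ≤
      ENNReal.ofReal (Real.exp (32 / 5 * (n * Real.log n) - j / (10 * n))) := by
  refine (secondRoundBad_le_prob_length α Bad j π).trans (prob_lt_length_le ?_ j)
  refine (ex_run_bind_pow_le (ex_matchRound_le hn hα)
    (fun _ => ex_matchRound_le hn hα) π).trans (le_of_eq ?_)
  rw [← ENNReal.ofReal_mul (Real.exp_pos _).le, ← Real.exp_add]
  ring_nf

/-- A geometric series whose ratio exp (-1/(10n)) is at most 1 - 1/(20n). -/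
theorem sum_exp_le (hn : 1 ≤ n) (κ : ℝ) (J N : ℕ) :
    ∑ i ∈ Finset.range N, Real.exp (κ - (J + i : ℕ) / (10 * n)) ≤
      20 * n * Real.exp (κ - J / (10 * n)) := by
  have hn0 : (1 : ℝ) ≤ n := by exact_mod_cast hn
  set x := Real.exp (-(1 / (10 * n))) with hx
  have hl0 : (0 : ℝ) < 1 / (10 * n) := by positivity
  have hl1 : (1 : ℝ) / (10 * n) ≤ 1 := by rw [div_le_one (by positivity)]; linarith
  have hx0 : 0 ≤ x := (Real.exp_pos _).le
  have hx1 : x ≤ 1 - 1 / (20 * n) := by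
    have h := Real.add_one_le_exp (1 / (10 * n) : ℝ)
    have h2 : x ≤ (1 + 1 / (10 * n) : ℝ)⁻¹ := by
      rw [hx, Real.exp_neg]
      exact inv_anti₀ (by positivity) (by linarith)
    refine h2.trans ?_
    rw [inv_le_iff_one_le_mul₀ (by positivity)]
    have h3 : (1 : ℝ) / (20 * n) = 1 / (10 * n) / 2 := by
      rw [div_div]; ring
    rw [h3]
    nlinarith
  have hpos : (0 : ℝ) < 1 / (20 * n) := by positivity
  have hgeom : ∑ i ∈ Finset.range N, x ^ i ≤ 20 * n := by
    refine ((summable_geometric_of_lt_one hx0 (by linarith)).sum_le_tsum _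
      (fun i _ => pow_nonneg hx0 i)).trans ?_
    rw [tsum_geometric_of_lt_one hx0 (by linarith)]
    calc (1 - x)⁻¹ ≤ (1 / (20 * n) : ℝ)⁻¹ := inv_anti₀ hpos (by linarith)
      _ = 20 * n := by rw [one_div, inv_inv]
  calc _ = ∑ i ∈ Finset.range N, x ^ i * Real.exp (κ - J / (10 * n)) := by
        refine Finset.sum_congr rfl fun i _ => ?_
        rw [hx, ← Real.exp_nat_mul, ← Real.exp_add]
        push_cast; ring_nf
    _ = (∑ i ∈ Finset.range N, x ^ i) * Real.exp (κ - J / (10 * n)) := by rw [Finset.sum_mul]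
    _ ≤ _ := by gcongr

/-- The first term is the probability that the initial round is still running. The sum over `j` is
split at `J`: below it the accuracy bound is used, above it the tail of the duration of two rounds.
`L` caps the duration of a single sort. -/
theorem prob_observe_bad_le {α : ℕ} (hn : 2 ≤ n) (hα : 400 * α ≤ n) (m L J t : ℕ)
    (π : Prefs n) (M : Matching n) :
    prob (observe α t ⟨π, M, matchRound n⟩) (fun s => 4 * n * m < numBlocking s.1 s.2) ≤
      ENNReal.ofReal (Real.exp (16 / 5 * (n * Real.log n) - t / (10 * n)) +
        (J * (2 * n * (Real.exp (8 / 5 * Real.log n - L / (10 * n)) +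
          Real.exp (L * (α * (2 / n)) - m / 2)) +
          2 * n * n * Real.exp (J * (α * (2 / n ^ 2)) - m / 2)) +
        20 * n * Real.exp (32 / 5 * (n * Real.log n) - J / (10 * n)))) := by
  set g := 2 * n * (Real.exp (8 / 5 * Real.log n - L / (10 * n)) +
          Real.exp (L * (α * (2 / n)) - m / 2)) +
          2 * n * n * Real.exp (J * (α * (2 / n ^ 2)) - m / 2) with hg
  have hg0 : 0 ≤ g := by positivity
  let γ : ℕ → ℝ := fun j => if j < J then g else Real.exp (32 / 5 * (n * Real.log n) - j / (10 * n))
  have hγ0 : ∀ j, 0 ≤ γ j := fun j => by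
    simp only [γ]; split_ifs
    · exact hg0
    · exact (Real.exp_pos _).le
  have hΓ : ∀ j π, secondRoundBad α (fun π M => 4 * n * m < numBlocking π M) j π ≤
      ENNReal.ofReal (γ j) := fun j π => by
    simp only [γ]
    split_ifs with hj
    · refine (secondRoundBad_le_ofReal hn hα m L j π).trans (ENNReal.ofReal_le_ofReal ?_)
      rw [hg]
      gcongr
    · exact secondRoundBad_le_tail hn hα _ j π
  refine (prob_observe_le hn hΓ t π M).trans ?_
  rw [ENNReal.ofReal_add (Real.exp_pos _).le (by positivity)]
  refine add_le_add ?_ ?_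
  · exact (prob_mono fun r hr => hr.1).trans (prob_lt_length_le (ex_matchRound_le hn hα π) t)
  · rw [← ENNReal.ofReal_sum_of_nonneg fun j _ => hγ0 j]
    refine ENNReal.ofReal_le_ofReal ?_
    -- The range is enlarged so that the splitting at `J` works even if `t < J`.
    calc ∑ j ∈ Finset.range (t + 1), γ j ≤ ∑ j ∈ Finset.range (J + (t + 1)), γ j :=
          Finset.sum_le_sum_of_subset_of_nonneg
            (Finset.range_subset_range.2 (by omega)) fun j _ _ => hγ0 j
      _ = ∑ j ∈ Finset.range J, γ j + ∑ i ∈ Finset.range (t + 1), γ (J + i) :=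
          Finset.sum_range_add _ _ _
      _ = J * g + ∑ i ∈ Finset.range (t + 1),
            Real.exp (32 / 5 * (n * Real.log n) - (J + i : ℕ) / (10 * n)) := by
          congr 1
          · rw [Finset.sum_congr rfl fun j hj => if_pos (Finset.mem_range.1 hj)]
            simp
          · exact Finset.sum_congr rfl fun i _ => if_neg (by omega)
      _ ≤ _ := by
          gcongr
          exact sum_exp_le (by omega) _ _ _

theorem ceil_le_two_mul {x : ℝ} (hx : 1 ≤ x) : (⌈x⌉₊ : ℝ) ≤ 2 * x := by
  linarith [Nat.ceil_lt_add_one (zero_le_one.trans hx)]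

/-- The choice of parameters: a sort is cut off at K n log n steps, two rounds at 100 n² log n, and
`m` is A log n. Two rounds have moment exponent 6.4 n log n, while 100 n² log n steps of weight
1/(10n) subtract 10 n log n. `A` exceeds the growth 4αK of the moments during a sort and 400α during
two rounds, with c + 10 to spare before doubling. -/
theorem failure_le {α : ℕ} {c K A : ℝ} (hc : 1 ≤ c) (hK : K = 10 * (c + 10))
    (hA : A = 2 * (c + 10 + 4 * α * K + 400 * α)) (hn : 4000 ≤ n) (hnc : c + 10 ≤ n) {t : ℝ}
    (ht : 100 * (n : ℝ) ^ 2 * Real.log n ≤ t) :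
    Real.exp (16 / 5 * (n * Real.log n) - t / (10 * n)) +
        (⌈100 * (n : ℝ) ^ 2 * Real.log n⌉₊ *
          (2 * n * (Real.exp (8 / 5 * Real.log n - ⌈K * n * Real.log n⌉₊ / (10 * n)) +
          Real.exp (⌈K * n * Real.log n⌉₊ * (α * (2 / n)) - ⌈A * Real.log n⌉₊ / 2)) +
          2 * n * n * Real.exp (⌈100 * (n : ℝ) ^ 2 * Real.log n⌉₊ * (α * (2 / n ^ 2)) -
            ⌈A * Real.log n⌉₊ / 2)) +
        20 * n * Real.exp (32 / 5 * (n * Real.log n) -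
          ⌈100 * (n : ℝ) ^ 2 * Real.log n⌉₊ / (10 * n))) ≤ Real.exp (-(c * Real.log n)) := by
  have hn' : (4000 : ℝ) ≤ n := by exact_mod_cast hn
  have hn0 : (0 : ℝ) < n := by linarith
  set ℓ := Real.log n with hℓ
  have hexp : Real.exp ℓ = n := Real.exp_log hn0
  have hℓ1 : 1 ≤ ℓ := by
    rw [hℓ, Real.le_log_iff_exp_le hn0]
    linarith [Real.exp_one_lt_d9]
  have hℓn : ℓ ≤ n := by rw [← hexp]; linarith [Real.add_one_le_exp ℓ]
  have hK1 : 1 ≤ K := by rw [hK]; linarith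
  have hα0 : (0 : ℝ) ≤ α := by positivity
  have hαK : 0 ≤ α * K := by positivity
  have hJ0 : 100 * (n : ℝ) ^ 2 * ℓ ≤ ⌈100 * (n : ℝ) ^ 2 * ℓ⌉₊ := Nat.le_ceil _
  have hJ1 : (⌈100 * (n : ℝ) ^ 2 * ℓ⌉₊ : ℝ) ≤ 2 * (100 * (n : ℝ) ^ 2 * ℓ) :=
    ceil_le_two_mul (by nlinarith)
  have hL0 : K * n * ℓ ≤ ⌈K * n * ℓ⌉₊ := Nat.le_ceil _
  have hKn : 1 ≤ K * n := by nlinarith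
  have hL1 : (⌈K * n * ℓ⌉₊ : ℝ) ≤ 2 * (K * n * ℓ) := ceil_le_two_mul (by nlinarith)
  have hm0 : A * ℓ ≤ ⌈A * ℓ⌉₊ := Nat.le_ceil _
  generalize (⌈100 * (n : ℝ) ^ 2 * ℓ⌉₊ : ℝ) = J at *
  generalize (⌈K * n * ℓ⌉₊ : ℝ) = L at *
  generalize (⌈A * ℓ⌉₊ : ℝ) = m at *
  have hround : ∀ s, 100 * (n : ℝ) ^ 2 * ℓ ≤ s → 10 * (n * ℓ) ≤ s / (10 * n) := fun s hs => by
    rw [le_div_iff₀ (by positivity)]; linarith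
  have hnl : (c + 10) * ℓ ≤ n * ℓ := by gcongr
  have hnl0 : 0 ≤ n * ℓ := by positivity
  -- `E` is n^(-(c+8)). Every exponential below is at most `E`; the polynomial prefactors, of order
  -- at most n⁵, are absorbed by n⁸.
  set E := Real.exp (-((c + 8) * ℓ)) with hE
  have hE0 : 0 < E := Real.exp_pos _
  have b1 : Real.exp (16 / 5 * (n * ℓ) - t / (10 * n)) ≤ E := by
    refine Real.exp_le_exp.2 ?_
    linarith [hround t ht]
  have b5 : Real.exp (32 / 5 * (n * ℓ) - J / (10 * n)) ≤ E := by
    refine Real.exp_le_exp.2 ?_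
    linarith [hround J hJ0]
  have b2 : Real.exp (8 / 5 * ℓ - L / (10 * n)) ≤ E := by
    refine Real.exp_le_exp.2 ?_
    have : (c + 10) * ℓ ≤ L / (10 * n) := by
      rw [le_div_iff₀ (by positivity)]
      calc _ = K * n * ℓ := by rw [hK]; ring
        _ ≤ L := hL0
    linarith
  have hmA : (c + 10) * ℓ + 4 * (α * K) * ℓ + 400 * α * ℓ ≤ m / 2 := by
    rw [hA] at hm0; linarith
  have b3 : Real.exp (L * (α * (2 / n)) - m / 2) ≤ E := by
    refine Real.exp_le_exp.2 ?_
    have : L * (α * (2 / n)) ≤ 4 * (α * K) * ℓ := by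
      calc _ ≤ 2 * (K * n * ℓ) * (α * (2 / n)) := by gcongr
        _ = _ := by field_simp; ring
    have : 0 ≤ 400 * α * ℓ := by positivity
    linarith
  have b4 : Real.exp (J * (α * (2 / n ^ 2)) - m / 2) ≤ E := by
    refine Real.exp_le_exp.2 ?_
    have : J * (α * (2 / n ^ 2)) ≤ 400 * α * ℓ := by
      calc _ ≤ 2 * (100 * (n : ℝ) ^ 2 * ℓ) * (α * (2 / n ^ 2)) := by gcongr
        _ = _ := by field_simp; ring
    have : 0 ≤ 4 * (α * K) * ℓ := by positivity
    linarith
  have hJ2 : J ≤ 200 * (n : ℝ) ^ 3 := by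
    calc J ≤ 2 * (100 * (n : ℝ) ^ 2 * ℓ) := hJ1
      _ ≤ 2 * (100 * (n : ℝ) ^ 2 * n) := by gcongr
      _ = _ := by ring
  have hEn : E * (n : ℝ) ^ 8 = Real.exp (-(c * ℓ)) := by
    rw [← hexp, ← Real.exp_nat_mul, hE, ← Real.exp_add]
    push_cast; ring_nf
  have hn1 : (1 : ℝ) ≤ n := by linarith
  calc _ ≤ E + (200 * (n : ℝ) ^ 3 * (2 * n * (E + E) + 2 * n * n * E) + 20 * n * E) := by gcongr
    _ = E * (1 + 800 * (n : ℝ) ^ 4 + 400 * n ^ 5 + 20 * n) := by ring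
    _ ≤ E * (n : ℝ) ^ 8 := by
        have h5 : (1 : ℝ) ≤ n ^ 5 := one_le_pow₀ hn1
        have h4 : (n : ℝ) ^ 4 ≤ n ^ 5 := pow_le_pow_right₀ hn1 (by norm_num)
        have h1 : (n : ℝ) ≤ n ^ 5 := le_self_pow₀ hn1 (by norm_num)
        have h8 : 4000 * (n : ℝ) ^ 5 ≤ n ^ 8 := by
          calc 4000 * (n : ℝ) ^ 5 ≤ n * n ^ 5 := by gcongr
            _ = (n : ℝ) ^ 6 := by ring
            _ ≤ n ^ 8 := pow_le_pow_right₀ hn1 (by norm_num)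
        gcongr
        linarith
    _ = _ := hEn

/-- With high probability there are few blocking pairs. -/
theorem blockingLaw_tail_le (α : ℕ) {c : ℝ} (hc : 1 ≤ c) :
    ∃ n₀ : ℕ, ∃ C : ℝ, 2 ≤ n₀ ∧ 0 < C ∧ ∀ n : ℕ, n₀ ≤ n →
      ∀ (π₀ : Prefs n) (M₀ : Matching n) (t : ℕ), 100 * (n : ℝ) ^ 2 * Real.log n ≤ (t : ℝ) →
        prob (blockingLaw α π₀ M₀ t) (fun k => C * ((n : ℝ) * Real.log n) < (k : ℝ)) ≤
          ENNReal.ofReal ((n : ℝ) ^ (-c)) := by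
  obtain ⟨K, hK⟩ : ∃ K : ℝ, K = 10 * (c + 10) := ⟨_, rfl⟩
  obtain ⟨A, hA⟩ : ∃ A : ℝ, A = 2 * (c + 10 + 4 * α * K + 400 * α) := ⟨_, rfl⟩
  have hK0 : 0 ≤ K := by rw [hK]; linarith
  have hA1 : 1 ≤ A := by
    have : 0 ≤ 4 * α * K + 400 * (α : ℝ) := by positivity
    rw [hA]; linarith
  -- The summands ensure `4000 ≤ n`, `400 * α ≤ n` and `c + 10 ≤ n`. The factor 8 is the 4 of `4 * n
  -- * m`, doubled to absorb the rounding of `m` up to an integer.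
  refine ⟨4000 + 400 * α + ⌈c + 10⌉₊, 8 * A, by omega, by linarith, ?_⟩
  intro n hn π₀ M₀ t ht
  have hnc : c + 10 ≤ n := (Nat.le_ceil _).trans (by exact_mod_cast (by omega : ⌈c + 10⌉₊ ≤ n))
  have hn0 : (0 : ℝ) < n := by linarith
  have hℓ1 : 1 ≤ Real.log n := by
    rw [Real.le_log_iff_exp_le hn0]
    linarith [Real.exp_one_lt_d9]
  rw [blockingLaw_eq, prob_map]
  refine (prob_mono (Q := fun s => 4 * n * ⌈A * Real.log n⌉₊ < numBlocking s.1 s.2)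
    fun s hs => ?_).trans ((prob_observe_bad_le (by omega) (by omega) ⌈A * Real.log n⌉₊
      ⌈K * n * Real.log n⌉₊ ⌈100 * (n : ℝ) ^ 2 * Real.log n⌉₊ t π₀ M₀).trans
      (ENNReal.ofReal_le_ofReal ?_))
  · have h1 := ceil_le_two_mul (x := A * Real.log n) (by nlinarith)
    have h2 : ((4 * n * ⌈A * Real.log n⌉₊ : ℕ) : ℝ) ≤ 8 * A * (n * Real.log n) := by
      push_cast
      calc (4 : ℝ) * n * ⌈A * Real.log n⌉₊ ≤ 4 * n * (2 * (A * Real.log n)) := by gcongr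
        _ = _ := by ring
    exact_mod_cast h2.trans_lt hs
  · refine (failure_le hc hK hA (by omega) hnc ht).trans_eq ?_
    rw [Real.rpow_def_of_pos hn0]
    ring_nf

/-- The expected number of blocking pairs from a tail bound. -/
theorem expectation_blockingLaw_le {α : ℕ} {π₀ : Prefs n} {M₀ : Matching n} {t : ℕ} {b : ℝ}
    (hb : 0 ≤ b) (hn : 1 ≤ n) (h : prob (blockingLaw α π₀ M₀ t) (fun k => b < (k : ℝ)) ≤
      ENNReal.ofReal ((n : ℝ) ^ (-2 : ℝ))) :
    expectation (blockingLaw α π₀ M₀ t) ≤ ENNReal.ofReal (b + 1) := by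
  have hn0 : (0 : ℝ) < n := by exact_mod_cast hn
  have he : expectation (blockingLaw α π₀ M₀ t) =
      ex (blockingLaw α π₀ M₀ t) fun k => (k : ℝ≥0∞) := rfl
  rw [he, ENNReal.ofReal_add hb zero_le_one, ENNReal.ofReal_one]
  -- E X ≤ b + n² Pr(X > b), and the tail n^(-2) cancels the trivial bound n².
  calc _ ≤ ex (blockingLaw α π₀ M₀ t) (fun k => ENNReal.ofReal b +
        ENNReal.ofReal ((n : ℝ) ^ 2) * if b < (k : ℝ) then 1 else 0) := by
        refine ex_mono_support fun k hk => ?_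
        rw [blockingLaw, PMF.mem_support_map_iff] at hk
        obtain ⟨s, -, rfl⟩ := hk
        split_ifs with hbk
        · rw [mul_one, ← ENNReal.ofReal_natCast]
          refine le_trans (ENNReal.ofReal_le_ofReal ?_) le_add_self
          rw [sq]
          exact_mod_cast numBlocking_le _ _
        · rw [mul_zero, add_zero, ← ENNReal.ofReal_natCast]
          exact ENNReal.ofReal_le_ofReal (not_lt.1 hbk)
    _ ≤ ENNReal.ofReal b + ENNReal.ofReal ((n : ℝ) ^ 2) * ENNReal.ofReal ((n : ℝ) ^ (-2 : ℝ)) := by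
        rw [ex_add, ex_const, ex_const_mul]
        refine add_le_add_right (mul_le_mul_right (le_trans (le_of_eq ?_) h) _) _
        unfold prob
        congr 1
    _ = _ := by
        rw [← ENNReal.ofReal_mul (by positivity), Real.rpow_neg hn0.le, Real.rpow_two,
          mul_inv_cancel₀ (by positivity), ENNReal.ofReal_one]

end EvolvingMatching

theorem mainTheorem3 (α : ℕ) (hα : 1 ≤ α) :
    ∃ c₀ : ℝ, 0 < c₀ ∧ ∀ c : ℝ, ∃ n₀ : ℕ, ∃ C₁ C₂ : ℝ, 0 < n₀ ∧ 0 < C₁ ∧ 0 < C₂ ∧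
      ∀ n : ℕ, n₀ ≤ n →
        ∀ (π₀ : EvolvingMatching.Prefs n) (M₀ : EvolvingMatching.Matching n) (t : ℕ),
          c₀ * (n : ℝ) ^ 2 * Real.log n ≤ (t : ℝ) →
            EvolvingMatching.expectation (EvolvingMatching.blockingLaw α π₀ M₀ t) ≤
                ENNReal.ofReal (C₁ * ((n : ℝ) * Real.log n)) ∧
              (EvolvingMatching.blockingLaw α π₀ M₀ t).toOuterMeasure
                  {k : ℕ | C₂ * ((n : ℝ) * Real.log n) < (k : ℝ)} ≤
                ENNReal.ofReal ((n : ℝ) ^ (-c)) := by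
  -- The value 100 does not depend on `α`: the rate only affects `n₀` and the other constants, since
  -- for large `n` the evolution hardly changes the duration of the sorts.
  refine ⟨100, by norm_num, fun c => ?_⟩
  obtain ⟨n₀, C, hn₀, hC, h⟩ :=
    -- Exponent at least 2 is needed for the expectation, at least `c` for the tail.
    EvolvingMatching.blockingLaw_tail_le α (c := max c 2) (le_max_of_le_right (by norm_num))
  -- With n ≥ 3 > e one has n log n ≥ 1, so raising `C` to `C + 1` absorbs the additive 1 in the
  -- bound on the expectation.
  refine ⟨n₀ + 3, C + 1, C, by omega, by linarith, hC, fun n hn π₀ M₀ t ht => ?_⟩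
  have hn3 : (3 : ℝ) ≤ n := by exact_mod_cast (by omega : 3 ≤ n)
  have hn1 : (1 : ℝ) ≤ n := by linarith
  have hlog : 1 ≤ Real.log n := by
    rw [Real.le_log_iff_exp_le (by linarith)]
    linarith [Real.exp_one_lt_d9]
  have htail := h n (by omega) π₀ M₀ t ht
  constructor
  · refine (EvolvingMatching.expectation_blockingLaw_le (b := C * (n * Real.log n))
      (by positivity) (by omega) (htail.trans (ENNReal.ofReal_le_ofReal ?_))).trans
      (ENNReal.ofReal_le_ofReal ?_)
    · exact Real.rpow_le_rpow_of_exponent_le hn1 (by linarith [le_max_right c 2])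
    · nlinarith
  · rw [EvolvingMatching.prob_eq_toOuterMeasure]
    refine htail.trans (ENNReal.ofReal_le_ofReal ?_)
    exact Real.rpow_le_rpow_of_exponent_le hn1 (by linarith [le_max_left c 2])
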